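/- Let $k$ be a field of characteristic $2$, let $n \ge 1$, and let $\Delta$ be a pseudo-manifold of dimension $n-1$ with vertices $v_1,\dots,v_N$: a non-empty pure $(n-1)$-dimensional finite simplicial complex in which every $(n-2)$-simplex (the empty simplex if $n=1$) lies in exactly two $(n-1)$-simplices and any two $(n-1)$-simplices are joined by a chain of $(n-1)$-simplices in which consecutive ones share an $(n-2)$-simplex. Let $K = k(a_{i,j})$, $1\le i\le n$, $1\le j\le N$, be the field of rational functions in independent variables $a_{i,j}$, and let $\mathcal A(\Delta) = K[x_1,\dots,x_N]/I_\Delta$ be the Stanley–Reisner ring. For an $(n-1)$-simplex $\sigma=\{v_{j_1},\dots,v_{j_n}\}$ and $f\in\mathcal A(\Delta)$ let $f_\sigma\in K[t_1,\dots,t_n]$ be obtained from $f$ by setting $x_j=0$ for $v_j\notin\sigma$ and inverting the substitution $t_i = \sum_r a_{i,j_r}x_{j_r}$; put $\chi_\sigma = \det(a_{i,j_r})_{i,r}\, x_{j_1}\cdots x_{j_n}$, also written in $t_1,\dots,t_n$, and $$\pi_\Delta(f) = \sum_{\sigma} \frac{f_\sigma}{\chi_\sigma}\in K(t_1,\dots,t_n),$$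 the sum being over all $(n-1)$-simplices $\sigma$ of $\Delta$. **Theorem.** For $f\in K[x_1,\dots,x_N]$ homogeneous of degree $n$ the value $W_\Delta(f) := \pi_\Delta(f)$ lies in $K$. Let $\overline H(\Delta)=K[x_1,\dots,x_N]/I$ be the graded algebra determined by $W_\Delta$, that is, $I$ is the homogeneous ideal that contains a homogeneous $f$ of degree $m\le n$ if and only if $W_\Delta(fg)=0$ for all homogeneous $g$ of degree $n-m$, and that contains everything of degree $>n$. Let $l = x_1+\cdots+x_N$. Then for every integer $0\le m\le n/2$ the quadratic form $$Q_l : \overline H^m(\Delta)\to K,\qquad Q_l(g) = W_\Delta(l^{\,n-2m}g^2),$$ is anisotropic: $Q_l(g)=0$ implies $g=0$. -/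

import Mathlib

open MvPolynomial

noncomputable section

/-- The maximal simplices of dimension `n - 1` (those with `n` vertices) of a simplicial complex
on the vertices `v_1, …, v_N`. -/
abbrev Facet {N : ℕ} (Δ : AbstractSimplicialComplex (Fin N)) (n : ℕ) : Type :=
  {σ : Finset (Fin N) // σ ∈ Δ.faces ∧ σ.card = n}

instance {N : ℕ} (Δ : AbstractSimplicialComplex (Fin N)) (n : ℕ) : Fintype (Facet Δ n) :=
  Fintype.ofFinite _

/-- `Δ` is a pseudo-manifold (with empty boundary) of dimension `n - 1`.
Mathlib's complexes do not list the empty simplex among their faces; in `two_facets` the simplex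
`τ` of dimension `n - 2` is any set of `n - 1` vertices contained in a face, which includes the
empty simplex when `n = 1`. -/
structure IsPseudomanifold {N : ℕ} (Δ : AbstractSimplicialComplex (Fin N)) (n : ℕ) : Prop where
  nonempty : Δ.faces.Nonempty
  /-- `Δ` is pure of dimension `n - 1`. -/
  pure : ∀ s ∈ Δ.faces, ∃ σ ∈ Δ.faces, s ⊆ σ ∧ σ.card = n
  /-- Every `(n - 2)`-simplex lies in exactly two `(n - 1)`-simplices. -/
  two_facets : ∀ τ : Finset (Fin N), τ.card + 1 = n → (∃ s ∈ Δ.faces, τ ⊆ s) →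
    {σ : Finset (Fin N) | σ ∈ Δ.faces ∧ σ.card = n ∧ τ ⊆ σ}.ncard = 2
  /-- `Δ` is strongly connected: any two maximal simplices are joined by a chain of maximal
  simplices in which consecutive ones share an `(n - 2)`-simplex. -/
  strongly_connected : ∀ σ σ' : Facet Δ n,
    Relation.ReflTransGen (fun ρ ρ' : Facet Δ n => (ρ.1 ∩ ρ'.1).card + 1 = n) σ σ'

section StanleyReisner

variable {K : Type*} [Field K] {n N : ℕ}

/-- The ideal generated by the square-free monomials `∏_{i ∈ S} x_i`, where `S` is not a simplex
(the empty set is a simplex). -/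
def stanleyReisnerIdeal (K : Type*) [Field K] {N : ℕ} (Δ : AbstractSimplicialComplex (Fin N)) :
    Ideal (MvPolynomial (Fin N) K) :=
  Ideal.span {p | ∃ S : Finset (Fin N), S.Nonempty ∧ S ∉ Δ.faces ∧ p = ∏ i ∈ S, X i}

/-- The Stanley-Reisner ring `𝒜(Δ)` over `K`. -/
abbrev StanleyReisnerRing (K : Type*) [Field K] {N : ℕ}
    (Δ : AbstractSimplicialComplex (Fin N)) : Type _ :=
  MvPolynomial (Fin N) K ⧸ stanleyReisnerIdeal K Δ

/-- For a maximal simplex `σ = {v_{j_1}, …, v_{j_n}}` with `j_1 < ⋯ < j_n`, the `n × n` matrix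
`(a_{i, j_r})_{i, r}` of the coefficients of `θ_1, …, θ_n` at the vertices of `σ`. -/
def facetMatrix (a : Matrix (Fin n) (Fin N) K) (σ : Finset (Fin N)) (h : σ.card = n) :
    Matrix (Fin n) (Fin n) K :=
  Matrix.of fun i r => a i (σ.orderEmbOfFin h r)

/-- The vertex variable `x_{j_r}` of `σ`, written in the coordinates `t_1, …, t_n` by inverting
`t_i = ∑_r a_{i, j_r} x_{j_r}`. -/
def facetCoord (a : Matrix (Fin n) (Fin N) K) (σ : Finset (Fin N)) (h : σ.card = n) (r : Fin n) :
    MvPolynomial (Fin n) K :=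
  ∑ i, C ((facetMatrix a σ h)⁻¹ r i) * X i

/-- If `det σ ≠ 0`, then `facetCoord` really inverts the substitution
`t_i = ∑_r a_{i, j_r} x_{j_r}`. -/
theorem sum_facetMatrix_mul_facetCoord (a : Matrix (Fin n) (Fin N) K) (σ : Finset (Fin N))
    (h : σ.card = n) (hdet : (facetMatrix a σ h).det ≠ 0) (i : Fin n) :
    ∑ r, C (facetMatrix a σ h i r) * facetCoord a σ h r = (X i : MvPolynomial (Fin n) K) := by
  have hmul : facetMatrix a σ h * (facetMatrix a σ h)⁻¹ = 1 :=
    Matrix.mul_nonsing_inv _ (isUnit_iff_ne_zero.mpr hdet)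
  have hent : ∀ s, ∑ r, facetMatrix a σ h i r * (facetMatrix a σ h)⁻¹ r s
      = (1 : Matrix (Fin n) (Fin n) K) i s := fun s => by
    rw [← hmul, Matrix.mul_apply]
  simp only [facetCoord, Finset.mul_sum]
  rw [Finset.sum_comm]
  have : ∀ s, ∑ r, C (facetMatrix a σ h i r) * (C ((facetMatrix a σ h)⁻¹ r s) * X s)
      = C ((1 : Matrix (Fin n) (Fin n) K) i s) * (X s : MvPolynomial (Fin n) K) := fun s => by
    rw [← hent s, map_sum, Finset.sum_mul]
    exact Finset.sum_congr rfl fun r _ => by rw [map_mul, mul_assoc]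
  simp [this, Matrix.one_apply]

/-- The map `f ↦ f_σ`, from `K[x_1, …, x_N]` to `K[t_1, …, t_n]`: set `x_j = 0` for `v_j ∉ σ`, and
then express the variables `x_{j_1}, …, x_{j_n}` in `t_1, …, t_n`. -/
def facetRestrictPoly (a : Matrix (Fin n) (Fin N) K) (σ : Finset (Fin N)) (h : σ.card = n) :
    MvPolynomial (Fin N) K →ₐ[K] MvPolynomial (Fin n) K :=
  aeval fun j =>
    if hj : j ∈ σ then facetCoord a σ h ((σ.orderIsoOfFin h).symm ⟨j, hj⟩) else 0

theorem facetRestrictPoly_eq_zero {Δ : AbstractSimplicialComplex (Fin N)}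
    (a : Matrix (Fin n) (Fin N) K) (σ : Facet Δ n) :
    ∀ p ∈ stanleyReisnerIdeal K Δ, facetRestrictPoly a σ.1 σ.2.2 p = 0 := by
  intro p hp
  have hle : stanleyReisnerIdeal K Δ ≤ RingHom.ker (facetRestrictPoly a σ.1 σ.2.2) := by
    refine Ideal.span_le.mpr ?_
    rintro _ ⟨S, hS, hSΔ, rfl⟩
    have hnot : ¬ S ⊆ σ.1 := fun hsub => hSΔ ((Δ.isRelLowerSet_faces σ.2.1).2 hsub hS)
    obtain ⟨j, hjS, hjσ⟩ := Finset.not_subset.mp hnot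
    rw [SetLike.mem_coe, RingHom.mem_ker, map_prod]
    exact Finset.prod_eq_zero hjS (by simp [facetRestrictPoly, hjσ])
  exact hle hp

/-- The component `f_σ ∈ K[t_1, …, t_n]` of an element `f` of the Stanley-Reisner ring, viewed as
a piecewise polynomial function. -/
def facetRestrict {Δ : AbstractSimplicialComplex (Fin N)} (a : Matrix (Fin n) (Fin N) K)
    (σ : Facet Δ n) : StanleyReisnerRing K Δ →ₐ[K] MvPolynomial (Fin n) K :=
  Ideal.Quotient.liftₐ _ (facetRestrictPoly a σ.1 σ.2.2) (facetRestrictPoly_eq_zero a σ)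

/-- `χ_σ = (det σ) x_{j_1} ⋯ x_{j_n} ∈ K[t_1, …, t_n]`. -/
def facetChi {Δ : AbstractSimplicialComplex (Fin N)} (a : Matrix (Fin n) (Fin N) K)
    (σ : Facet Δ n) : MvPolynomial (Fin n) K :=
  C (facetMatrix a σ.1 σ.2.2).det * ∏ r, facetCoord a σ.1 σ.2.2 r

/-- Brion's integration map `π_Δ(f) = ∑_σ f_σ / χ_σ`, with values in `K(t_1, …, t_n)`, where `σ`
runs over the maximal simplices, for a field `K` of characteristic `2`. (In characteristic `2` every
ordering of the vertices of the maximal simplices is an orientation, and we use the increasing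
one.) -/
def brionIntegral (Δ : AbstractSimplicialComplex (Fin N)) (a : Matrix (Fin n) (Fin N) K) :
    StanleyReisnerRing K Δ →ₗ[K] FractionRing (MvPolynomial (Fin n) K) where
  toFun f := ∑ σ : Facet Δ n,
    algebraMap (MvPolynomial (Fin n) K) (FractionRing (MvPolynomial (Fin n) K))
        (facetRestrict a σ f) /
      algebraMap (MvPolynomial (Fin n) K) (FractionRing (MvPolynomial (Fin n) K)) (facetChi a σ)
  map_add' f g := by simp only [map_add, add_div, Finset.sum_add_distrib]
  map_smul' c f := by
    simp only [map_smul, RingHom.id_apply, Algebra.smul_def, map_mul,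
      ← IsScalarTower.algebraMap_apply, mul_div_assoc, Finset.mul_sum]

/-- A `K`-linear retraction of `K(t_1, …, t_n)` onto `K`. It is only used to regard elements of
`K ⊆ K(t_1, …, t_n)` as elements of `K`. -/
def toBaseField (n : ℕ) (K : Type*) [Field K] :
    FractionRing (MvPolynomial (Fin n) K) →ₗ[K] K :=
  (LinearMap.exists_leftInverse_of_injective
    (Algebra.linearMap K (FractionRing (MvPolynomial (Fin n) K)))
    (LinearMap.ker_eq_bot.mpr (FaithfulSMul.algebraMap_injective K _))).choose

theorem toBaseField_algebraMap (c : K) :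
    toBaseField n K (algebraMap K (FractionRing (MvPolynomial (Fin n) K)) c) = c :=
  LinearMap.congr_fun (LinearMap.exists_leftInverse_of_injective
    (Algebra.linearMap K (FractionRing (MvPolynomial (Fin n) K)))
    (LinearMap.ker_eq_bot.mpr (FaithfulSMul.algebraMap_injective K _))).choose_spec c

/-- The mixed volume `W_Δ : K[x_1, …, x_N]_n → 𝒜ⁿ(Δ) → K`, extended by zero to the homogeneous
polynomials of degree `≠ n`. (On degree `n` the values of `π_Δ` lie in `K` when `Δ` is a
pseudo-manifold and the coefficients `a` are generic.) -/
def mixedVolume (Δ : AbstractSimplicialComplex (Fin N)) (a : Matrix (Fin n) (Fin N) K) :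
    MvPolynomial (Fin N) K →ₗ[K] K :=
  toBaseField n K ∘ₗ brionIntegral Δ a ∘ₗ
    (Ideal.Quotient.mkₐ K (stanleyReisnerIdeal K Δ)).toLinearMap ∘ₗ homogeneousComponent n

/-- The ideal of the Gorenstein algebra determined by `W_Δ`: the homogeneous ideal whose part of
degree `m ≤ n` consists of all `f` with `W_Δ(f g) = 0` for every `g` of degree `n - m`, and which
contains everything of degree `> n`. -/
def gorensteinIdeal (Δ : AbstractSimplicialComplex (Fin N)) (a : Matrix (Fin n) (Fin N) K) :
    Ideal (MvPolynomial (Fin N) K) where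
  carrier := {f | ∀ g, mixedVolume Δ a (f * g) = 0}
  zero_mem' g := by simp
  add_mem' {f f'} hf hf' g := by
    rw [add_mul, map_add, hf g, hf' g, add_zero]
  smul_mem' c f hf g := by
    rw [smul_eq_mul, mul_comm c f, mul_assoc]
    exact hf (c * g)

/-- The degreewise description of the ideal of the Gorenstein algebra. -/
theorem mem_gorensteinIdeal_iff (Δ : AbstractSimplicialComplex (Fin N))
    (a : Matrix (Fin n) (Fin N) K) {m : ℕ} (hm : m ≤ n) {f : MvPolynomial (Fin N) K}
    (hf : f.IsHomogeneous m) :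
    f ∈ gorensteinIdeal Δ a ↔
      ∀ g : MvPolynomial (Fin N) K, g.IsHomogeneous (n - m) → mixedVolume Δ a (f * g) = 0 := by
  refine ⟨fun h g _ => h g, fun h g => ?_⟩
  rw [← sum_homogeneousComponent g, Finset.mul_sum, map_sum]
  refine Finset.sum_eq_zero fun i _ => ?_
  by_cases hi : i = n - m
  · exact h _ (hi ▸ homogeneousComponent_isHomogeneous i g)
  · have hne : m + i ≠ n := by omega
    have h0 : homogeneousComponent n (f * homogeneousComponent i g) = 0 := by
      rw [homogeneousComponent_of_mem (hf.mul (homogeneousComponent_isHomogeneous i g)),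
        if_neg (Ne.symm hne)]
    simp [mixedVolume, h0]

/-- The algebra `H̄(Δ)` determined by `W_Δ`. -/
abbrev HBar (Δ : AbstractSimplicialComplex (Fin N)) (a : Matrix (Fin n) (Fin N) K) : Type _ :=
  MvPolynomial (Fin N) K ⧸ gorensteinIdeal Δ a

/-- The graded piece `H̄ᵐ(Δ)`: the image of the homogeneous polynomials of degree `m`. -/
def hBarDegree (Δ : AbstractSimplicialComplex (Fin N)) (a : Matrix (Fin n) (Fin N) K) (m : ℕ) :
    Submodule K (HBar Δ a) :=
  (homogeneousSubmodule (Fin N) K m).map (Ideal.Quotient.mkₐ K (gorensteinIdeal Δ a)).toLinearMap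

/-- The linear function `H̄(Δ) → K` induced by `W_Δ`; on `H̄ⁿ(Δ)` it is the identification of
`H̄ⁿ(Δ)` with `K`. -/
def hBarIntegral (Δ : AbstractSimplicialComplex (Fin N)) (a : Matrix (Fin n) (Fin N) K) :
    HBar Δ a →ₗ[K] K :=
  ((gorensteinIdeal Δ a).restrictScalars K).liftQ (mixedVolume Δ a) (fun f hf => by
    simpa using (hf : ∀ g, mixedVolume Δ a (f * g) = 0) 1)

/-- `l = x_1 + ⋯ + x_N` in `H̄(Δ)`. -/
def lefschetzElement (Δ : AbstractSimplicialComplex (Fin N)) (a : Matrix (Fin n) (Fin N) K) :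
    HBar Δ a :=
  Ideal.Quotient.mk (gorensteinIdeal Δ a) (∑ j, X j)

/-- The quadratic form `Q_l(g) = l^{n - 2m} g²` on `H̄ᵐ(Δ)`, for `2 m ≤ n`, with values in
`H̄ⁿ(Δ) ≃ K`. -/
def lefschetzForm (Δ : AbstractSimplicialComplex (Fin N)) (a : Matrix (Fin n) (Fin N) K) (m : ℕ) :
    QuadraticForm K (hBarDegree Δ a m) :=
  (LinearMap.BilinMap.toQuadraticMap ((LinearMap.mul K (HBar Δ a)).compr₂
    (hBarIntegral Δ a ∘ₗ LinearMap.mulLeft K (lefschetzElement Δ a ^ (n - 2 * m))))).comp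
    (hBarDegree Δ a m).subtype

theorem lefschetzForm_apply (Δ : AbstractSimplicialComplex (Fin N)) (a : Matrix (Fin n) (Fin N) K)
    (m : ℕ) (g : hBarDegree Δ a m) :
    lefschetzForm Δ a m g =
      hBarIntegral Δ a (lefschetzElement Δ a ^ (n - 2 * m) * (g : HBar Δ a) ^ 2) := by
  simp [lefschetzForm, pow_two]

end StanleyReisner

/-- The field `K = k(a_{i,j})` of rational functions in the indeterminates `a_{i,j}`,
`1 ≤ i ≤ n`, `1 ≤ j ≤ N`. -/
abbrev GenericField (k : Type*) [Field k] (n N : ℕ) : Type _ :=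
  FractionRing (MvPolynomial (Fin n × Fin N) k)

/-- The matrix of indeterminates `a_{i,j}`, the coefficients of the generic linear parameters
`θ_i = ∑_j a_{i,j} x_j`. -/
def genericMatrix (k : Type*) [Field k] (n N : ℕ) : Matrix (Fin n) (Fin N) (GenericField k n N) :=
  Matrix.of fun i j => algebraMap (MvPolynomial (Fin n × Fin N) k) (GenericField k n N) (X (i, j))

/-- The determinants `det σ` of the generic matrix are nonzero. -/
theorem det_facetMatrix_genericMatrix_ne_zero (k : Type*) [Field k] {n N : ℕ}
    (σ : Finset (Fin N)) (h : σ.card = n) :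
    (facetMatrix (genericMatrix k n N) σ h).det ≠ 0 := by
  have hmap : facetMatrix (genericMatrix k n N) σ h =
      (algebraMap (MvPolynomial (Fin n × Fin N) k) (GenericField k n N)).mapMatrix
        ((rename (fun p : Fin n × Fin n => (p.1, σ.orderEmbOfFin h p.2))).toRingHom.mapMatrix
          (Matrix.mvPolynomialX (Fin n) (Fin n) k)) := by
    ext i j
    simp [facetMatrix, genericMatrix, Matrix.mvPolynomialX]
  rw [hmap, ← RingHom.map_det, ← RingHom.map_det]
  refine (map_ne_zero_iff _ (IsFractionRing.injective _ _)).mpr ?_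
  refine (map_ne_zero_iff _ (rename_injective _ ?_)).mpr (Matrix.det_mvPolynomialX_ne_zero (Fin n) k)
  rintro ⟨i, j⟩ ⟨i', j'⟩ hij
  simp only [Prod.mk.injEq, EmbeddingLike.apply_eq_iff_eq] at hij
  exact Prod.ext hij.1 hij.2

end

/-!
The proof rests on one expression for the mixed volume. Write `y^σ` for the coordinates of a vector
`p ∈ Kⁿ` with respect to the columns `a_j`, `j ∈ σ`. If no coordinate `y^σ_j` with `j ∈ σ` vanishes,
then, for `f` homogeneous of degree `n`,
`π_Δ(f) = ∑_σ f(y^σ) / (det σ · ∏_{j ∈ σ} y^σ_j)`,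
which is the value of `π_Δ(f)` at `t = p` and lies in `K` (`brionIntegral_mk_eq_integralAt`). To see
this, cone off the complex with an apex at `p`. For each facet `σ`, Lagrange interpolation of a monic
polynomial of degree `n` at `n + 1` nodes says that the contributions to the integral of all facets
of the simplex spanned by `σ` and the apex add up to the term of `σ` on the right
(`add_sum_apexTerm`). The contribution of the facet spanned by the apex and `τ = σ \ {r}` depends on
`τ` only (`apexTerm_eq_of_erase_eq`). As `τ` lies in exactly two facets of `Δ`, these contributions
cancel in characteristic two (`sum_facets_eq`).

Now take `p` to be a standard basis vector. The matrix `c_{r,j} = a_{r,j} y^σ_j` then has row sums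
`0` except for one row sum `1`, and for such a matrix in characteristic two the sum of the products
`∏_r c_{r, I_r}` over all words `I` whose letters have prescribed parities (of total parity `n`) is
always `det c` (`sum_filter_parity_prod_eq_det`, a computation in the group algebra of `(ℤ/2)ⁿ`).
Consequently
`W(g² x^J) = ∑_I a_{1,I_1} ⋯ a_{n,I_n} · W(g √(x^J x_I))²`,
the sum being over the words `I` for which `x^J x_I` is a square (`integralAt_sq_mul_sum_monomial`).
The square-free monomials `a_{1,I_1} ⋯ a_{n,I_n}` are linearly independent over the squares in `K`
(`eq_zero_of_sum_monomial_mul_sq_eq_zero`). So if the left side vanishes for all `J` of the right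
degree, then `W(g x^M) = 0` for all `M`, that is, `g = 0` in `H̄(Δ)`. The same argument applies to
`l g²` in place of `g²`, because at most one of the terms `x_j` of `l` can make `x_j x^J x_I` a
square. Finally `l^s g² = 0` implies `l^{⌊s/2⌋} g = 0`, hence `l^{⌊s/2⌋} g² = 0`, and descending
on `s` gives `g = 0` (`mem_gorensteinIdeal_of_pow_mul_sq_mem`).
-/

noncomputable section

/-! ### Products of linear forms and parity sums in characteristic two -/

/-- In square-zero commuting elements, a product of linear forms picks out the permanent of the
coefficients, which is the determinant in characteristic two. -/
theorem prod_sum_smul_eq_det_smul_prod {R G ι : Type*} [CommRing R] [CharP R 2] [CommRing G]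
    [Algebra R G] [Fintype ι] [DecidableEq ι] (c : Matrix ι ι R) (ε : ι → G)
    (hε : ∀ j, ε j * ε j = 0) :
    ∏ r, ∑ j, c r j • ε j = c.det • ∏ j, ε j := by
  rw [Finset.prod_univ_sum, Fintype.piFinset_univ, ← Matrix.det_transpose, Matrix.det_apply',
    Finset.sum_smul]
  have h1 : ∀ I : ι → ι, ¬ Function.Bijective I → ∏ r, c r (I r) • ε (I r) = 0 := by
    intro I hI
    have hinj : ¬ Function.Injective I := fun h => hI (Finite.injective_iff_bijective.mp h)
    simp only [Function.Injective, not_forall] at hinj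
    obtain ⟨r, s, hrs, hne⟩ := hinj
    rw [← Finset.mul_prod_erase _ _ (Finset.mem_univ r),
      ← Finset.mul_prod_erase _ _ (Finset.mem_erase.mpr ⟨Ne.symm hne, Finset.mem_univ s⟩),
      ← mul_assoc, hrs, smul_mul_smul_comm, hε, smul_zero, zero_mul]
  rw [← Finset.sum_filter_add_sum_filter_not _ (fun I : ι → ι => Function.Bijective I),
    Finset.sum_eq_zero (s := Finset.filter (fun I => ¬ Function.Bijective I) _)
      (fun I hI => h1 I (Finset.mem_filter.mp hI).2), add_zero]
  symm
  refine Finset.sum_bij (fun (π : Equiv.Perm ι) _ => (π : ι → ι)) (fun π _ => by simp)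
    (fun π _ π' _ h => Equiv.coe_fn_injective h)
    (fun I hI => ⟨Equiv.ofBijective I (Finset.mem_filter.mp hI).2, Finset.mem_univ _, rfl⟩) ?_
  intro π _
  have hs : ((Equiv.Perm.sign π : ℤ) : R) = 1 := by
    rcases Int.units_eq_one_or (Equiv.Perm.sign π) with h | h <;> simp [h, CharTwo.neg_eq]
  rw [hs, one_mul, Finset.prod_smul, Equiv.prod_comp π ε]
  rfl

/-- If all rows of `c` sum to `0` except for row `r₀`, which sums to `1`, then in terms of the
square-zero elements `1 + z j` row `r₀` is `1` plus a linear form and the others are linear forms. -/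
theorem prod_sum_smul_eq_add_det_smul {R G ι : Type*} [CommRing R] [CharP R 2] [CommRing G]
    [Algebra R G] [Fintype ι] [DecidableEq ι] (c : Matrix ι ι R) (r₀ : ι)
    (hc : ∀ r, ∑ j, c r j = if r = r₀ then 1 else 0) (z : ι → G) (hz : ∀ j, z j * z j = 1) :
    ∏ r, ∑ j, c r j • z j =
      ∏ r ∈ Finset.univ.erase r₀, ∑ j, c r j • z j + c.det • ∏ j, (1 + z j) := by
  have h2 : ∀ x : G, x + x = 0 := fun x => by
    rw [← two_smul R x, CharTwo.two_eq_zero, zero_smul]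
  have hrow : ∀ r, ∑ j, c r j • z j = (if r = r₀ then 1 else 0) + ∑ j, c r j • (1 + z j) := by
    intro r
    simp only [smul_add, Finset.sum_add_distrib, ← Finset.sum_smul, hc]
    split_ifs <;> simp [← add_assoc, h2]
  rw [← prod_sum_smul_eq_det_smul_prod c (fun j => 1 + z j)
      (fun j => by linear_combination hz j + h2 (z j) + h2 1),
    ← Finset.mul_prod_erase _ _ (Finset.mem_univ r₀),
    ← Finset.mul_prod_erase _ (fun r => ∑ j, c r j • (1 + z j)) (Finset.mem_univ r₀)]
  have he : ∏ r ∈ Finset.univ.erase r₀, ∑ j, c r j • z j =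
      ∏ r ∈ Finset.univ.erase r₀, ∑ j, c r j • (1 + z j) :=
    Finset.prod_congr rfl fun r hr => by
      rw [hrow r, if_neg (Finset.ne_of_mem_erase hr), zero_add]
  rw [he, hrow r₀, if_pos rfl, add_mul, one_mul]

theorem prod_sum_smul_single {R ι κ M : Type*} [CommRing R] [AddCommMonoid M] [Fintype ι]
    [Fintype κ] [DecidableEq κ] (c : κ → ι → R) (e : ι → M) :
    ∏ r, ∑ j, c r j • AddMonoidAlgebra.single (e j) (1 : R) =
      ∑ I : κ → ι, AddMonoidAlgebra.single (∑ r, e (I r)) (∏ r, c r (I r)) := by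
  classical
  have hmul : ∀ (s : Finset κ) (v : κ → M) (w : κ → R),
      ∏ r ∈ s, AddMonoidAlgebra.single (v r) (w r) =
        AddMonoidAlgebra.single (∑ r ∈ s, v r) (∏ r ∈ s, w r) := by
    intro s v w
    induction s using Finset.induction_on with
    | empty => simp [AddMonoidAlgebra.one_def]
    | insert a s ha ih =>
      rw [Finset.prod_insert ha, Finset.sum_insert ha, ih, AddMonoidAlgebra.single_mul_single,
        Finset.prod_insert ha]
  simp only [AddMonoidAlgebra.smul_single, smul_eq_mul, mul_one]
  rw [Finset.prod_univ_sum, Fintype.piFinset_univ]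
  exact Finset.sum_congr rfl fun I _ => hmul _ _ _

/-- The sum of the products `∏ r, c r (I r)` over the words `I` in which each letter `j` occurs with
parity `T j`. It is the coefficient at `T` of `∏ r, ∑ j, c r j • z j` in the group algebra of
`ι → ZMod 2`, where `z j` is the `j`-th generator. -/
theorem sum_filter_parity_prod_eq_det {R ι : Type*} [CommRing R] [CharP R 2]
    [Fintype ι] [DecidableEq ι] (c : Matrix ι ι R) (r₀ : ι)
    (hc : ∀ r, ∑ j, c r j = if r = r₀ then 1 else 0) (T : ι → ZMod 2)
    (hT : ∑ j, T j = Fintype.card ι) :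
    ∑ I : ι → ι with ∑ r, Pi.single (I r) 1 = T, ∏ r, c r (I r) = c.det := by
  classical
  let z : ι → AddMonoidAlgebra R (ι → ZMod 2) := fun j => AddMonoidAlgebra.single (Pi.single j 1) 1
  have hz : ∀ j, z j * z j = 1 := fun j => by
    have : (1 : ZMod 2) + 1 = 0 := rfl
    simp only [z, AddMonoidAlgebra.single_mul_single, ← Pi.single_add, this, one_mul,
      Pi.single_zero, AddMonoidAlgebra.one_def]
  have key := congrArg (fun x => AddMonoidAlgebra.coeff x T)
    (prod_sum_smul_eq_add_det_smul c r₀ hc z hz)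
  have hcoeff : ∀ {α : Type _} (s : Finset α) (v : α → ι → ZMod 2) (w : α → R),
      (∑ i ∈ s, AddMonoidAlgebra.single (v i) (w i)).coeff T = ∑ i ∈ s with v i = T, w i := by
    intro α s v w
    rw [AddMonoidAlgebra.coeff_sum, Finsupp.finsetSum_apply, Finset.sum_filter]
    exact Finset.sum_congr rfl fun i _ => by
      rw [AddMonoidAlgebra.coeff_single, Finsupp.single_apply]
  -- A product of `card ι - 1` linear forms is supported on the wrong parity for `T`.
  have hQ : (∏ r ∈ Finset.univ.erase r₀, ∑ j, c r j • z j).coeff T = 0 := by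
    rw [← Finset.prod_coe_sort, prod_sum_smul_single (fun r : Finset.univ.erase r₀ => c r),
      hcoeff]
    refine Finset.sum_eq_zero fun I hI => ?_
    exfalso
    have h := congrArg (fun v : ι → ZMod 2 => ∑ j, v j) (Finset.mem_filter.mp hI).2
    simp only [Finset.sum_apply, hT] at h
    rw [Finset.sum_comm] at h
    simp only [Finset.sum_pi_single', Finset.mem_univ, if_true, Finset.sum_const, Finset.card_univ,
      Fintype.card_coe, Finset.card_erase_of_mem, nsmul_eq_mul, mul_one] at h
    have hpos : 0 < Fintype.card ι := Fintype.card_pos_iff.mpr ⟨r₀⟩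
    obtain ⟨d, hd⟩ : ∃ d, Fintype.card ι = d + 1 := ⟨_, (Nat.succ_pred_eq_of_pos hpos).symm⟩
    rw [hd] at h
    simp at h
  -- Every element of the group is a product of a unique set of generators.
  have hP : (∏ j, (1 + z j)).coeff T = 1 := by
    rw [Finset.prod_one_add]
    have : ∀ t : Finset ι, ∏ i ∈ t, z i =
        AddMonoidAlgebra.single (∑ i ∈ t, Pi.single i (1 : ZMod 2)) (1 : R) := by
      intro t
      induction t using Finset.induction_on with
      | empty => simp [AddMonoidAlgebra.one_def]
      | insert a t ha ih =>
        rw [Finset.prod_insert ha, Finset.sum_insert ha, ih, AddMonoidAlgebra.single_mul_single,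
          one_mul]
    simp only [this]
    rw [hcoeff]
    have hind : ∀ t : Finset ι, ∑ i ∈ t, Pi.single i (1 : ZMod 2) = T ↔
        t = Finset.univ.filter fun i => T i = 1 := by
      intro t
      have h01 : ∀ x : ZMod 2, x = 0 ∨ x = 1 := by decide
      have hap : ∀ j, (∑ i ∈ t, Pi.single i (1 : ZMod 2) : ι → ZMod 2) j =
          if j ∈ t then 1 else 0 := fun j => by
        rw [Finset.sum_apply, Finset.sum_pi_single]
      constructor
      · rintro rfl
        ext j
        simp [hap]
      · rintro rfl
        funext j
        rw [hap]
        rcases h01 (T j) with h | h <;> simp [h]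
    simp [hind, Finset.filter_eq']
  rw [AddMonoidAlgebra.coeff_add, AddMonoidAlgebra.coeff_smul, Finsupp.add_apply, hQ,
    Finsupp.smul_apply, hP, zero_add, smul_eq_mul, mul_one,
    prod_sum_smul_single (fun r => c r) (fun j => Pi.single j 1), hcoeff] at key
  exact key

theorem Lagrange.sum_eval_monic_div {F ι : Type*} [Field F] [DecidableEq ι] {s : Finset ι}
    {u : ι → F} (hu : Set.InjOn u s) {P : Polynomial F} (hP : P.Monic)
    (hdeg : s.card = P.natDegree + 1) :
    ∑ i ∈ s, P.eval (u i) / ∏ j ∈ s.erase i, (u i - u j) = 1 := by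
  rw [← hP.leadingCoeff]
  exact (Lagrange.leadingCoeff_eq_sum hu (by
    rw [hdeg, Polynomial.degree_eq_natDegree hP.ne_zero]; norm_cast)).symm

theorem MvPolynomial.sq_eq_sum_monomial {R σ : Type*} [CommRing R] [CharP R 2]
    (p : MvPolynomial σ R) :
    p ^ 2 = ∑ m ∈ p.support, monomial (2 • m) (p.coeff m ^ 2) := by
  conv_lhs => rw [p.as_sum]
  rw [CharTwo.sum_sq]
  exact Finset.sum_congr rfl fun m _ => by rw [monomial_pow]

/-- Distinct square-free monomials in the indeterminates are linearly independent over the subfield of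
squares of a field of rational functions of characteristic two. -/
theorem eq_zero_of_sum_monomial_mul_sq_eq_zero {k σ ι : Type*} [Field k] [CharP k 2] [Fintype ι]
    {e : ι → σ →₀ ℕ} (he : Function.Injective e) (he1 : ∀ i s, e i s ≤ 1)
    {w : ι → FractionRing (MvPolynomial σ k)}
    (h : ∑ i, algebraMap (MvPolynomial σ k) (FractionRing (MvPolynomial σ k))
      (monomial (e i) 1) * w i ^ 2 = 0) (i : ι) : w i = 0 := by
  classical
  obtain ⟨b, hb⟩ := IsLocalization.exist_integer_multiples_of_finite
    (nonZeroDivisors (MvPolynomial σ k)) w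
  choose p hp using hb
  have hb0 : algebraMap (MvPolynomial σ k) (FractionRing (MvPolynomial σ k)) b ≠ 0 :=
    IsFractionRing.to_map_ne_zero_of_mem_nonZeroDivisors b.2
  have hpoly : ∑ i, monomial (e i) 1 * p i ^ 2 = 0 := by
    apply IsFractionRing.injective (MvPolynomial σ k) (FractionRing (MvPolynomial σ k))
    rw [map_sum, map_zero]
    calc _ = (algebraMap (MvPolynomial σ k) (FractionRing (MvPolynomial σ k)) b) ^ 2 *
          ∑ i, algebraMap (MvPolynomial σ k) (FractionRing (MvPolynomial σ k))
            (monomial (e i) 1) * w i ^ 2 := by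
          rw [Finset.mul_sum]
          refine Finset.sum_congr rfl fun i _ => ?_
          rw [map_mul, map_pow, hp i, Algebra.smul_def]
          ring
      _ = 0 := by rw [h, mul_zero]
  have hpi : p i = 0 := by
    ext m
    have hc := congrArg (coeff (e i + 2 • m)) hpoly
    -- A square has even exponents only, so the exponent `e i + 2 m` determines `i` and `m`.
    have hterm : ∀ j, coeff (e i + 2 • m) (monomial (e j) 1 * p j ^ 2) =
        if j = i then coeff m (p i) ^ 2 else 0 := by
      intro j
      rw [sq_eq_sum_monomial, Finset.mul_sum, coeff_sum]
      simp only [monomial_mul, one_mul, coeff_monomial]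
      have hiff : ∀ m', e j + 2 • m' = e i + 2 • m ↔ j = i ∧ m' = m := by
        intro m'
        refine ⟨fun hm => ?_, by rintro ⟨rfl, rfl⟩; rfl⟩
        have hs : ∀ s, e j s = e i s ∧ m' s = m s := fun s => by
          have h1 := DFunLike.congr_fun hm s
          have h2 := he1 j s
          have h3 := he1 i s
          simp only [Finsupp.add_apply, Finsupp.smul_apply, smul_eq_mul] at h1
          omega
        exact ⟨he (Finsupp.ext fun s => (hs s).1), Finsupp.ext fun s => (hs s).2⟩
      simp only [hiff]
      by_cases hj : j = i
      · subst hj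
        simp +contextual [Finset.sum_ite_eq']
      · simp [hj]
    rw [coeff_sum, coeff_zero] at hc
    simp only [hterm, Finset.sum_ite_eq', Finset.mem_univ, if_true] at hc
    simpa using hc
  have := hp i
  rw [hpi, map_zero, Algebra.smul_def] at this
  exact (mul_eq_zero.mp this.symm).resolve_left hb0

/-! ### Coordinates on facets and the cancellation over the cone -/

theorem sum_orderEmbOfFin {M : Type*} [AddCommMonoid M] {n N : ℕ} {σ : Finset (Fin N)}
    (h : σ.card = n) {f : Fin N → M} (hf : ∀ j ∉ σ, f j = 0) :
    ∑ r, f (σ.orderEmbOfFin h r) = ∑ j, f j := by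
  rw [← Finset.sum_subset (Finset.subset_univ σ) fun j _ hj => hf j hj]
  conv_rhs => rw [← Finset.map_orderEmbOfFin_univ σ h]
  rw [Finset.sum_map]
  rfl

theorem prod_orderEmbOfFin {M : Type*} [CommMonoid M] {n N : ℕ} {σ : Finset (Fin N)}
    (h : σ.card = n) (f : Fin N → M) :
    ∏ r, f (σ.orderEmbOfFin h r) = ∏ j ∈ σ, f j := by
  conv_rhs => rw [← Finset.map_orderEmbOfFin_univ σ h]
  rw [Finset.prod_map]
  rfl

/-- `Y` is the family of coordinates of the vector `b` with respect to the columns of `a` indexed by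
`σ`, extended by zero to all vertices. -/
structure IsFacetCoords {L : Type*} [Field L] {n N : ℕ} (a : Matrix (Fin n) (Fin N) L)
    (σ : Finset (Fin N)) (b : Fin n → L) (Y : Fin N → L) : Prop where
  eq_zero : ∀ j ∉ σ, Y j = 0
  sum_eq : ∀ i, ∑ j, a i j * Y j = b i

section

variable {L : Type*} [Field L] {n N : ℕ} {a : Matrix (Fin n) (Fin N) L}

theorem facetMatrix_mulVec_comp {σ : Finset (Fin N)} (h : σ.card = n) {Y : Fin N → L}
    (hY : ∀ j ∉ σ, Y j = 0) (i : Fin n) :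
    (facetMatrix a σ h).mulVec (fun r => Y (σ.orderEmbOfFin h r)) i = ∑ j, a i j * Y j := by
  rw [← sum_orderEmbOfFin h (f := fun j => a i j * Y j) fun j hj => by simp [hY j hj]]
  rfl

theorem IsFacetCoords.unique {σ : Finset (Fin N)} (h : σ.card = n)
    (hdet : (facetMatrix a σ h).det ≠ 0) {b : Fin n → L} {Y Z : Fin N → L}
    (hY : IsFacetCoords a σ b Y) (hZ : IsFacetCoords a σ b Z) : Y = Z := by
  have h0 : (fun r => Y (σ.orderEmbOfFin h r)) = fun r => Z (σ.orderEmbOfFin h r) := by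
    apply Matrix.mulVec_injective_of_isUnit
      ((Matrix.isUnit_iff_isUnit_det _).mpr (isUnit_iff_ne_zero.mpr hdet))
    funext i
    rw [facetMatrix_mulVec_comp h hY.eq_zero, facetMatrix_mulVec_comp h hZ.eq_zero, hY.sum_eq,
      hZ.sum_eq]
  funext j
  by_cases hj : j ∈ σ
  · have := congrFun h0 ((σ.orderIsoOfFin h).symm ⟨j, hj⟩)
    simpa [← Finset.coe_orderIsoOfFin_apply] using this
  · rw [hY.eq_zero j hj, hZ.eq_zero j hj]

/-- The coordinates of `b` with respect to the columns of `a` indexed by `σ`, obtained by inverting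
the matrix of these columns. -/
def facetSolve (a : Matrix (Fin n) (Fin N) L) (σ : Finset (Fin N)) (h : σ.card = n)
    (b : Fin n → L) (j : Fin N) : L :=
  if hj : j ∈ σ then (facetMatrix a σ h)⁻¹.mulVec b ((σ.orderIsoOfFin h).symm ⟨j, hj⟩) else 0

theorem facetSolve_orderEmbOfFin (σ : Finset (Fin N)) (h : σ.card = n) (b : Fin n → L)
    (r : Fin n) : facetSolve a σ h b (σ.orderEmbOfFin h r) = (facetMatrix a σ h)⁻¹.mulVec b r := by
  rw [facetSolve, dif_pos (Finset.orderEmbOfFin_mem σ h r)]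
  congr 1
  rw [OrderIso.symm_apply_eq]
  exact Subtype.ext (Finset.coe_orderIsoOfFin_apply σ h r).symm

theorem isFacetCoords_facetSolve (σ : Finset (Fin N)) (h : σ.card = n)
    (hdet : (facetMatrix a σ h).det ≠ 0) (b : Fin n → L) :
    IsFacetCoords a σ b (facetSolve a σ h b) := by
  have h0 : ∀ j ∉ σ, facetSolve a σ h b j = 0 := fun j hj => by rw [facetSolve, dif_neg hj]
  refine ⟨h0, fun i => ?_⟩
  rw [← facetMatrix_mulVec_comp h h0]
  simp only [facetSolve_orderEmbOfFin]
  rw [Matrix.mulVec_mulVec, Matrix.mul_nonsing_inv _ (isUnit_iff_ne_zero.mpr hdet),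
    Matrix.one_mulVec]

/-- Comparison of the coordinates with respect to two facets `σ`, `σ'` with a common codimension-one
face, where `κ` are the coordinates on `σ` of the vertex `r'` of `σ'` opposite to this face. -/
theorem IsFacetCoords.exchange {σ σ' : Finset (Fin N)} {r r' : Fin N}
    (h : σ.card = n) (hdet : (facetMatrix a σ h).det ≠ 0) (hr' : r' ∉ σ)
    (hτ : σ.erase r = σ'.erase r') {b : Fin n → L} {κ Y Y' : Fin N → L}
    (hκ : IsFacetCoords a σ (fun i => a i r') κ) (hY : IsFacetCoords a σ b Y)
    (hY' : IsFacetCoords a σ' b Y') {i : Fin N} (hi : i ≠ r') :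
    Y i = Y' i + κ i * Y' r' := by
  have hZ : IsFacetCoords a σ b fun i => if i = r' then 0 else Y' i + κ i * Y' r' := by
    constructor
    · intro j hj
      split_ifs with hjr
      · rfl
      · have : j ∉ σ' := fun hj' => hj (Finset.mem_of_mem_erase
          (hτ ▸ Finset.mem_erase.mpr ⟨hjr, hj'⟩ : j ∈ σ.erase r))
        rw [hY'.eq_zero j this, hκ.eq_zero j hj]
        ring
    · intro i
      have h1 : ∀ j, a i j * (if j = r' then 0 else Y' j + κ j * Y' r') =
          a i j * Y' j + (a i j * κ j) * Y' r' - if j = r' then a i j * Y' r' else 0 := by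
        intro j
        split_ifs with hj
        · subst hj
          rw [hκ.eq_zero j hr']
          ring
        · ring
      simp only [h1, Finset.sum_sub_distrib, Finset.sum_add_distrib, ← Finset.sum_mul, hκ.sum_eq,
        hY'.sum_eq]
      simp
  have := congrFun (hY.unique h hdet hZ) i
  rwa [if_neg hi] at this

variable [CharP L 2]

/-- In characteristic two the determinant does not depend on the order of the vertices. -/
theorem det_comp_eq_det_facetMatrix {σ : Finset (Fin N)} (h : σ.card = n) {g : Fin n → Fin N}
    (hg : Function.Injective g) (hgσ : ∀ s, g s ∈ σ) :
    (Matrix.of fun i s => a i (g s)).det = (facetMatrix a σ h).det := by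
  let π : Fin n → Fin n := fun s => (σ.orderIsoOfFin h).symm ⟨g s, hgσ s⟩
  have hπ : Function.Injective π := fun s t hst => by
    have := (σ.orderIsoOfFin h).symm.injective hst
    exact hg (congrArg Subtype.val this)
  let e : Equiv.Perm (Fin n) := Equiv.ofBijective π (Finite.injective_iff_bijective.mp hπ)
  have hs : ((Equiv.Perm.sign e : ℤ) : L) = 1 := by
    rcases Int.units_eq_one_or (Equiv.Perm.sign e) with h | h <;> simp [h, CharTwo.neg_eq]
  have : (Matrix.of fun i s => a i (g s)) = (facetMatrix a σ h).submatrix id e := by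
    ext i s
    simp [facetMatrix, e, π, ← Finset.coe_orderIsoOfFin_apply]
  rw [this, Matrix.det_permute', hs, one_mul]

/-- Cramer's rule for the vertex `r'` of `σ'`, in the basis given by the adjacent facet `σ`. -/
theorem IsFacetCoords.det_mul {σ σ' : Finset (Fin N)} {r r' : Fin N}
    (h : σ.card = n) (h' : σ'.card = n) (hdet : (facetMatrix a σ h).det ≠ 0)
    (hr : r ∈ σ) (hr₁ : r' ∈ σ') (hr' : r' ∉ σ) (hτ : σ.erase r = σ'.erase r') {κ : Fin N → L}
    (hκ : IsFacetCoords a σ (fun i => a i r') κ) :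
    (facetMatrix a σ h).det * κ r = (facetMatrix a σ' h').det := by
  set A := facetMatrix a σ h with hA
  let r₀ := (σ.orderIsoOfFin h).symm ⟨r, hr⟩
  have hr₀ : σ.orderEmbOfFin h r₀ = r := by simp [r₀, ← Finset.coe_orderIsoOfFin_apply]
  have h1 : A.cramer (fun i => a i r') = A.det • fun s => κ (σ.orderEmbOfFin h s) := by
    apply Matrix.mulVec_injective_of_isUnit
      ((Matrix.isUnit_iff_isUnit_det _).mpr (isUnit_iff_ne_zero.mpr hdet))
    rw [Matrix.mulVec_cramer, Matrix.mulVec_smul]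
    congr 1
    funext i
    rw [facetMatrix_mulVec_comp h hκ.eq_zero, hκ.sum_eq]
  have h2 := congrFun h1 r₀
  rw [Matrix.cramer_apply, Pi.smul_apply, hr₀, smul_eq_mul] at h2
  have hne : ∀ s, σ.orderEmbOfFin h s ≠ r' := fun s hs =>
    hr' (hs ▸ Finset.orderEmbOfFin_mem σ h s)
  rw [← h2, ← det_comp_eq_det_facetMatrix h' (g := Function.update (σ.orderEmbOfFin h) r₀ r')]
  · congr 1
    ext i s
    by_cases hs : s = r₀
    · subst hs; simp
    · simp [hs, hA, facetMatrix]
  · intro s t hst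
    by_cases hs : s = r₀ <;> by_cases ht : t = r₀
    · rw [hs, ht]
    · subst hs
      rw [Function.update_self, Function.update_of_ne ht] at hst
      exact absurd hst.symm (hne t)
    · subst ht
      rw [Function.update_self, Function.update_of_ne hs] at hst
      exact absurd hst (hne s)
    · rw [Function.update_of_ne hs, Function.update_of_ne ht] at hst
      exact (σ.orderEmbOfFin h).injective hst
  · intro s
    by_cases hs : s = r₀
    · subst hs; rwa [Function.update_self]
    · rw [Function.update_of_ne hs]
      refine Finset.mem_of_mem_erase (hτ ▸ Finset.mem_erase.mpr
        ⟨fun h3 => hs ?_, Finset.orderEmbOfFin_mem σ h s⟩ : _ ∈ σ'.erase r')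
      exact (σ.orderEmbOfFin h).injective (h3.trans hr₀.symm)

/-- The contribution to the integral of `x^J` of the simplex spanned by `σ \ {r}` and an apex, where
`Y` and `y` are the coordinates on `σ` of the argument `t` and of the apex, and `D = det σ`. On that
simplex `t` has the coordinates `Y i + y i * (Y r / y r)` at the vertices `i ≠ r` of `σ` and
`Y r / y r` at the apex, and the determinant is `D * y r`; signs are those of characteristic two. -/
def apexTerm (D : L) (Y y : Fin N → L) (J : Fin N → ℕ) (σ : Finset (Fin N)) (r : Fin N) : L :=
  (∏ i, (Y i + y i * (Y r / y r)) ^ J i) /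
    (D * Y r * ∏ i ∈ σ.erase r, (Y i + y i * (Y r / y r)))

/-- The contribution of the simplex spanned by a codimension-one face and the apex does not depend on
the facet through which the face is reached. -/
theorem apexTerm_eq_of_erase_eq {σ σ' : Finset (Fin N)} {r r' : Fin N} (h : σ.card = n)
    (h' : σ'.card = n) (hdet : (facetMatrix a σ h).det ≠ 0) (hr : r ∈ σ) (hr₁ : r' ∈ σ')
    (hσ : σ ≠ σ') (hτ : σ.erase r = σ'.erase r') {T p : Fin n → L} {Y Y' y y' : Fin N → L}
    (hY : IsFacetCoords a σ T Y) (hY' : IsFacetCoords a σ' T Y')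
    (hy : IsFacetCoords a σ p y) (hy' : IsFacetCoords a σ' p y')
    (hyr : y r ≠ 0) (J : Fin N → ℕ) :
    apexTerm (facetMatrix a σ h).det Y y J σ r =
      apexTerm (facetMatrix a σ' h').det Y' y' J σ' r' := by
  have hrr : r ≠ r' := by
    rintro rfl
    exact hσ (by rw [← Finset.insert_erase hr, hτ, Finset.insert_erase hr₁])
  have hr' : r' ∉ σ := fun hm => by
    have : r' ∈ σ'.erase r' := hτ ▸ Finset.mem_erase.mpr ⟨Ne.symm hrr, hm⟩
    simp at this
  have hr₂ : r ∉ σ' := fun hm => by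
    have : r ∈ σ.erase r := hτ ▸ Finset.mem_erase.mpr ⟨hrr, hm⟩
    simp at this
  have hκ := isFacetCoords_facetSolve σ h hdet fun i => a i r'
  set κ := facetSolve a σ h fun i => a i r'
  have hYe : ∀ i, i ≠ r' → Y i = Y' i + κ i * Y' r' := fun i hi =>
    IsFacetCoords.exchange h hdet hr' hτ hκ hY hY' hi
  have hye : ∀ i, i ≠ r' → y i = y' i + κ i * y' r' := fun i hi =>
    IsFacetCoords.exchange h hdet hr' hτ hκ hy hy' hi
  have hYr : Y r = κ r * Y' r' := by rw [hYe r hrr, hY'.eq_zero r hr₂, zero_add]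
  have hyr' : y r = κ r * y' r' := by rw [hye r hrr, hy'.eq_zero r hr₂, zero_add]
  have hκr : κ r ≠ 0 := fun h0 => hyr (by rw [hyr', h0, zero_mul])
  have hy0 : y' r' ≠ 0 := fun h0 => hyr (by rw [hyr', h0, mul_zero])
  have hdiv : Y r / y r = Y' r' / y' r' := by rw [hYr, hyr', mul_div_mul_left _ _ hκr]
  have hterm : ∀ i, Y i + y i * (Y r / y r) = Y' i + y' i * (Y' r' / y' r') := by
    intro i
    by_cases hi : i = r'
    · subst hi
      rw [hY.eq_zero i hr', hy.eq_zero i hr', mul_div_cancel₀ _ hy0, CharTwo.add_self_eq_zero]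
      ring
    · rw [hdiv, hYe i hi, hye i hi]
      have : y' r' * (Y' r' / y' r') = Y' r' := mul_div_cancel₀ _ hy0
      linear_combination κ i * this + κ i * CharTwo.add_self_eq_zero (Y' r')
  rw [apexTerm, apexTerm, Finset.prod_congr rfl fun i _ => by rw [hterm i], hτ,
    Finset.prod_congr (s₁ := σ'.erase r') rfl fun i _ => hterm i,
    ← IsFacetCoords.det_mul h h' hdet hr hr₁ hr' hτ hκ, hYr]
  simp only [mul_assoc]

/-- The contributions of all facets of the simplex spanned by `σ` and an apex add up to the value of
the term of `σ` at the apex. This is Lagrange interpolation of a monic polynomial of degree `n` at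
the `n + 1` nodes `Y j / y j`, for `j ∈ σ`, and `0`, the latter belonging to the apex. -/
theorem add_sum_apexTerm {σ : Finset (Fin N)} (D : L) {Y y : Fin N → L}
    (hY0 : ∀ j ∉ σ, Y j = 0) (hy0 : ∀ j ∉ σ, y j = 0)
    (hY : ∀ j ∈ σ, Y j ≠ 0) (hy : ∀ j ∈ σ, y j ≠ 0)
    (hne : ∀ i ∈ σ, ∀ j ∈ σ, i ≠ j → Y i * y j ≠ Y j * y i) {J : Fin N → ℕ}
    (hJ : ∑ j, J j = σ.card) :
    (∏ j, Y j ^ J j) / (D * ∏ j ∈ σ, Y j) + ∑ r ∈ σ, apexTerm D Y y J σ r =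
      (∏ j, y j ^ J j) / (D * ∏ j ∈ σ, y j) := by
  -- If `x^J` involves a vertex outside `σ`, then all terms vanish.
  by_cases hsupp : ∀ j, J j ≠ 0 → j ∈ σ
  swap
  · push Not at hsupp
    obtain ⟨j, hj, hjσ⟩ := hsupp
    have h1 : ∏ j, Y j ^ J j = 0 :=
      Finset.prod_eq_zero (Finset.mem_univ j) (by rw [hY0 j hjσ, zero_pow hj])
    have h2 : ∏ j, y j ^ J j = 0 :=
      Finset.prod_eq_zero (Finset.mem_univ j) (by rw [hy0 j hjσ, zero_pow hj])
    have h3 : ∀ r, apexTerm D Y y J σ r = 0 := fun r => by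
      rw [apexTerm, Finset.prod_eq_zero (Finset.mem_univ j)
        (by rw [hY0 j hjσ, hy0 j hjσ, zero_mul, add_zero, zero_pow hj]), zero_div]
    simp [h1, h2, h3]
  let u : Option (Fin N) → L := fun o => o.elim 0 fun j => Y j / y j
  have hu : Set.InjOn u (Finset.insertNone σ) := by
    intro o ho o' ho' h
    match o, o' with
    | none, none => rfl
    | none, some j =>
      have hj : j ∈ σ := Finset.some_mem_insertNone.mp ho'
      exact absurd h.symm (div_ne_zero (hY j hj) (hy j hj))
    | some j, none =>
      have hj : j ∈ σ := Finset.some_mem_insertNone.mp ho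
      exact absurd h (div_ne_zero (hY j hj) (hy j hj))
    | some i, some j =>
      have hi : i ∈ σ := Finset.some_mem_insertNone.mp ho
      have hj : j ∈ σ := Finset.some_mem_insertNone.mp ho'
      by_contra hij
      exact hne i hi j hj (fun h' => hij (congrArg some h'))
        ((div_eq_div_iff (hy i hi) (hy j hj)).mp h)
  let P : Polynomial L := ∏ j, (Polynomial.X - Polynomial.C (Y j / y j)) ^ J j
  have hP : P.Monic := Polynomial.monic_prod_of_monic _ _ fun j _ =>
    (Polynomial.monic_X_sub_C _).pow _
  have hdeg : (Finset.insertNone σ).card = P.natDegree + 1 := by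
    rw [Finset.card_insertNone, Polynomial.natDegree_prod_of_monic _ _ fun j _ =>
      (Polynomial.monic_X_sub_C _).pow _]
    simp [hJ]
  have key := Lagrange.sum_eval_monic_div hu hP hdeg
  have hlin : ∀ j ∈ σ, ∀ x, y j * (x - Y j / y j) = Y j + y j * x := fun j hj x => by
    rw [mul_sub, mul_div_cancel₀ _ (hy j hj), CharTwo.sub_eq_add, add_comm]
  have hPe : ∀ x, (∏ j, y j ^ J j) * P.eval x = ∏ j, (Y j + y j * x) ^ J j := by
    intro x
    simp only [P, Polynomial.eval_prod, Polynomial.eval_pow, Polynomial.eval_sub,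
      Polynomial.eval_X, Polynomial.eval_C]
    rw [← Finset.prod_mul_distrib]
    refine Finset.prod_congr rfl fun j _ => ?_
    by_cases hj : J j = 0
    · simp [hj]
    · rw [← mul_pow, hlin j (hsupp j hj)]
  have hprod : ∀ s ⊆ σ, ∀ x, (∏ j ∈ s, y j) * ∏ j ∈ s, (x - Y j / y j) =
      ∏ j ∈ s, (Y j + y j * x) := by
    intro s hs x
    rw [← Finset.prod_mul_distrib]
    exact Finset.prod_congr rfl fun j hj => hlin j (hs hj) x
  have herase : ∀ r, (Finset.insertNone σ).erase (some r) = Finset.insertNone (σ.erase r) := by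
    intro r
    ext o
    cases o <;> simp
  have herase' : (Finset.insertNone σ).erase none = σ.map Function.Embedding.some := by
    ext o
    cases o <;> simp
  rw [Finset.sum_insertNone, herase', Finset.prod_map] at key
  simp only [herase, Finset.prod_insertNone] at key
  rw [← mul_one ((∏ j, y j ^ J j) / (D * ∏ j ∈ σ, y j)), ← key, mul_add, Finset.mul_sum]
  congr 1
  · simp only [u, Option.elim, Function.Embedding.some_apply]
    rw [div_mul_div_comm, hPe, mul_assoc, hprod σ subset_rfl]
    simp
  · refine Finset.sum_congr rfl fun r hr => ?_
    simp only [u, Option.elim, sub_zero]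
    rw [div_mul_div_comm, hPe, apexTerm, ← hprod _ (Finset.erase_subset r σ),
      ← Finset.mul_prod_erase σ y hr]
    congr 1
    have : y r * (Y r / y r) = Y r := mul_div_cancel₀ _ (hy r hr)
    linear_combination (-D * (∏ j ∈ σ.erase r, y j) *
      ∏ j ∈ σ.erase r, (Y r / y r - Y j / y j)) * this

/-- The sum `∑_σ f_σ / χ_σ` takes the same value at `t = T` and at `t = p`, if `f = x^J` has degree
`n`. -/
theorem sum_facets_eq {Δ : AbstractSimplicialComplex (Fin N)} (hΔ : IsPseudomanifold Δ n)
    (hdet : ∀ σ : Facet Δ n, (facetMatrix a σ.1 σ.2.2).det ≠ 0) {T p : Fin n → L}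
    {Y y : Facet Δ n → Fin N → L} (hY : ∀ σ, IsFacetCoords a σ.1 T (Y σ))
    (hy : ∀ σ, IsFacetCoords a σ.1 p (y σ))
    (hY0 : ∀ σ, ∀ j ∈ σ.1, Y σ j ≠ 0) (hy0 : ∀ σ, ∀ j ∈ σ.1, y σ j ≠ 0)
    (hne : ∀ σ, ∀ i ∈ σ.1, ∀ j ∈ σ.1, i ≠ j → Y σ i * y σ j ≠ Y σ j * y σ i)
    {J : Fin N → ℕ} (hJ : ∑ j, J j = n) :
    ∑ σ : Facet Δ n, (∏ j, Y σ j ^ J j) / ((facetMatrix a σ.1 σ.2.2).det * ∏ j ∈ σ.1, Y σ j) =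
      ∑ σ : Facet Δ n,
        (∏ j, y σ j ^ J j) / ((facetMatrix a σ.1 σ.2.2).det * ∏ j ∈ σ.1, y σ j) := by
  classical
  simp only [← fun σ : Facet Δ n => add_sum_apexTerm (facetMatrix a σ.1 σ.2.2).det
    (hY σ).eq_zero (hy σ).eq_zero (hY0 σ) (hy0 σ)
    (hne σ) (hJ.trans σ.2.2.symm)]
  -- Collect the apex terms according to the codimension-one face `τ = σ \ {r}`.
  rw [Finset.sum_add_distrib, left_eq_add, Finset.sum_sigma',
    ← Finset.sum_fiberwise _ fun x : (_ : Facet Δ n) × Fin N => x.1.1.erase x.2]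
  refine Finset.sum_eq_zero fun τ _ => ?_
  set S : Finset ((_ : Facet Δ n) × Fin N) :=
    Finset.filter (fun x => x.1.1.erase x.2 = τ) (Finset.univ.sigma fun σ : Facet Δ n => σ.1)
    with hS
  have hmem : ∀ x : (_ : Facet Δ n) × Fin N, x ∈ S ↔ x.2 ∈ x.1.1 ∧ x.1.1.erase x.2 = τ := by
    intro x
    simp [hS]
  rcases S.eq_empty_or_nonempty with hempty | ⟨x₀, hx₀⟩
  · rw [hempty, Finset.sum_empty]
  obtain ⟨hx₁, hx₂⟩ := (hmem x₀).mp hx₀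
  have hcard : τ.card + 1 = n := by
    rw [← hx₂, Finset.card_erase_add_one hx₁, x₀.1.2.2]
  have hfac := hΔ.two_facets τ hcard ⟨x₀.1.1, x₀.1.2.1, hx₂ ▸ Finset.erase_subset _ _⟩
  obtain ⟨σ₁, σ₂, hσ, hset⟩ := Set.ncard_eq_two.mp hfac
  have hx : ∀ σ ∈ ({σ₁, σ₂} : Set (Finset (Fin N))), ∃ x ∈ S, x.1.1 = σ := by
    intro σ hσ'
    rw [← hset] at hσ'
    obtain ⟨h1, h2, h3⟩ := hσ'
    obtain ⟨r, hr, hins⟩ := (Finset.covBy_iff_exists_insert.mp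
      (Finset.covBy_iff_card_sdiff_eq_one.mpr ⟨h3, by
        rw [Finset.card_sdiff_of_subset h3]; omega⟩))
    exact ⟨⟨⟨σ, h1, h2⟩, r⟩, (hmem _).mpr ⟨by simp [← hins], by
      simp [← hins, Finset.erase_insert hr]⟩, rfl⟩
  have hinj : ∀ x ∈ S, ∀ x' ∈ S, x.1.1 = x'.1.1 → x = x' := by
    rintro ⟨⟨σ, h1⟩, r⟩ hx ⟨⟨σ', h1'⟩, r'⟩ hx' (rfl : σ = σ')
    obtain ⟨h2, h3⟩ := (hmem _).mp hx
    obtain ⟨h2', h3'⟩ := (hmem _).mp hx'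
    have : r = r' := Finset.erase_injOn σ h2 h2' (h3.trans h3'.symm)
    subst this
    rfl
  obtain ⟨x₁, hx₁S, hxσ₁⟩ := hx σ₁ (by simp)
  obtain ⟨x₂, hx₂S, hxσ₂⟩ := hx σ₂ (by simp)
  have hne12 : x₁ ≠ x₂ := fun h => hσ (by rw [← hxσ₁, ← hxσ₂, h])
  have hSeq : S = {x₁, x₂} := by
    ext x
    rw [Finset.mem_insert, Finset.mem_singleton]
    refine ⟨fun hxS => ?_, by rintro (rfl | rfl) <;> assumption⟩
    have h1 := (hmem x).mp hxS
    have h2 : x.1.1 ∈ ({σ₁, σ₂} : Set (Finset (Fin N))) := by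
      rw [← hset]
      exact ⟨x.1.2.1, x.1.2.2, h1.2 ▸ Finset.erase_subset _ _⟩
    rcases h2 with h2 | h2
    · exact Or.inl (hinj x hxS x₁ hx₁S (h2.trans hxσ₁.symm))
    · exact Or.inr (hinj x hxS x₂ hx₂S (h2.trans hxσ₂.symm))
  have e₁ := (hmem x₁).mp hx₁S
  have e₂ := (hmem x₂).mp hx₂S
  rw [hSeq, Finset.sum_pair hne12, apexTerm_eq_of_erase_eq x₁.1.2.2 x₂.1.2.2 (hdet _) e₁.1 e₂.1
    (by rw [hxσ₁, hxσ₂]; exact hσ) (e₁.2.trans e₂.2.symm) (hY _) (hY _) (hy _) (hy _)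
    (hy0 _ _ e₁.1), CharTwo.add_self_eq_zero]

end

/-! ### The integral as a sum of values at a point -/

section

variable {K : Type*} [Field K] {n N : ℕ} (a : Matrix (Fin n) (Fin N) K)

theorem eval_facetCoord (σ : Finset (Fin N)) (h : σ.card = n)
    (hdet : (facetMatrix a σ h).det ≠ 0) (r s : Fin n) :
    eval (fun i => facetMatrix a σ h i s) (facetCoord a σ h r) = if r = s then 1 else 0 := by
  have hmul := congrFun (congrFun (Matrix.nonsing_inv_mul _ (isUnit_iff_ne_zero.mpr hdet)) r) s
  rw [Matrix.mul_apply, Matrix.one_apply] at hmul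
  simp [facetCoord, hmul]

theorem facetRestrictPoly_X_orderEmbOfFin (σ : Finset (Fin N)) (h : σ.card = n) (r : Fin n) :
    facetRestrictPoly a σ h (X (σ.orderEmbOfFin h r)) = facetCoord a σ h r := by
  rw [facetRestrictPoly, aeval_X, dif_pos (Finset.orderEmbOfFin_mem σ h r)]
  congr 1
  rw [OrderIso.symm_apply_eq]
  exact Subtype.ext (Finset.coe_orderIsoOfFin_apply σ h r).symm

theorem facetRestrictPoly_X_of_notMem {σ : Finset (Fin N)} (h : σ.card = n) {j : Fin N}
    (hj : j ∉ σ) : facetRestrictPoly a σ h (X j) = 0 := by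
  rw [facetRestrictPoly, aeval_X, dif_neg hj]

theorem exists_orderEmbOfFin_eq {σ : Finset (Fin N)} (h : σ.card = n) {j : Fin N} (hj : j ∈ σ) :
    ∃ r, σ.orderEmbOfFin h r = j :=
  ⟨(σ.orderIsoOfFin h).symm ⟨j, hj⟩, by simp [← Finset.coe_orderIsoOfFin_apply]⟩

theorem algebraMap_facetChi {Δ : AbstractSimplicialComplex (Fin N)} (σ : Facet Δ n) :
    algebraMap (MvPolynomial (Fin n) K) (FractionRing (MvPolynomial (Fin n) K)) (facetChi a σ) =
      algebraMap K (FractionRing (MvPolynomial (Fin n) K)) (facetMatrix a σ.1 σ.2.2).det *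
        ∏ j ∈ σ.1, algebraMap (MvPolynomial (Fin n) K) (FractionRing (MvPolynomial (Fin n) K))
          (facetRestrictPoly a σ.1 σ.2.2 (X j)) := by
  rw [← prod_orderEmbOfFin σ.2.2, facetChi, map_mul, map_prod,
    IsScalarTower.algebraMap_apply K (MvPolynomial (Fin n) K), algebraMap_eq]
  simp only [facetRestrictPoly_X_orderEmbOfFin]

/-- The value at the point `t = p` of the rational function `∑_σ f_σ / χ_σ`, meaningful when no
coordinate of `p` on a facet vanishes. -/
def integralAt (Δ : AbstractSimplicialComplex (Fin N)) (p : Fin n → K) :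
    MvPolynomial (Fin N) K →ₗ[K] K :=
  ∑ σ : Facet Δ n, ((facetMatrix a σ.1 σ.2.2).det * ∏ j ∈ σ.1, facetSolve a σ.1 σ.2.2 p j)⁻¹ •
    (aeval (facetSolve a σ.1 σ.2.2 p)).toLinearMap

theorem integralAt_apply (Δ : AbstractSimplicialComplex (Fin N)) (p : Fin n → K)
    (f : MvPolynomial (Fin N) K) :
    integralAt a Δ p f = ∑ σ : Facet Δ n, eval (facetSolve a σ.1 σ.2.2 p) f /
      ((facetMatrix a σ.1 σ.2.2).det * ∏ j ∈ σ.1, facetSolve a σ.1 σ.2.2 p j) := by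
  simp [integralAt, LinearMap.sum_apply, div_eq_inv_mul, aeval_eq_eval]

/-- In degree `n` the integral is a constant, equal to its value at any sufficiently general point. -/
theorem brionIntegral_mk_eq_integralAt [CharP K 2] {Δ : AbstractSimplicialComplex (Fin N)}
    (hΔ : IsPseudomanifold Δ n) (hdet : ∀ σ : Facet Δ n, (facetMatrix a σ.1 σ.2.2).det ≠ 0)
    {p : Fin n → K} (hp : ∀ σ : Facet Δ n, ∀ j ∈ σ.1, facetSolve a σ.1 σ.2.2 p j ≠ 0)
    {f : MvPolynomial (Fin N) K} (hf : f.IsHomogeneous n) :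
    brionIntegral Δ a (Ideal.Quotient.mk (stanleyReisnerIdeal K Δ) f) =
      algebraMap K (FractionRing (MvPolynomial (Fin n) K)) (integralAt a Δ p f) := by
  set φ := algebraMap K (FractionRing (MvPolynomial (Fin n) K)) with hφ
  set ψ := algebraMap (MvPolynomial (Fin n) K) (FractionRing (MvPolynomial (Fin n) K)) with hψ
  have hφψ : ∀ c, φ c = ψ (C c) := fun c => by
    rw [hφ, IsScalarTower.algebraMap_apply K (MvPolynomial (Fin n) K), algebraMap_eq]
  have hψi : Function.Injective ψ := IsFractionRing.injective _ _
  have : CharP (FractionRing (MvPolynomial (Fin n) K)) 2 :=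
    charP_of_injective_algebraMap φ.injective 2
  have hmat : ∀ σ : Facet Δ n, facetMatrix (a.map φ) σ.1 σ.2.2 =
      φ.mapMatrix (facetMatrix a σ.1 σ.2.2) := fun σ => rfl
  have hdet' : ∀ σ : Facet Δ n, (facetMatrix (a.map φ) σ.1 σ.2.2).det =
      φ (facetMatrix a σ.1 σ.2.2).det := fun σ => by rw [hmat, RingHom.map_det]
  let Y : Facet Δ n → Fin N → FractionRing (MvPolynomial (Fin n) K) := fun σ j =>
    ψ (facetRestrictPoly a σ.1 σ.2.2 (X j))
  let y : Facet Δ n → Fin N → FractionRing (MvPolynomial (Fin n) K) := fun σ j =>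
    φ (facetSolve a σ.1 σ.2.2 p j)
  have hY : ∀ σ : Facet Δ n, IsFacetCoords (a.map φ) σ.1 (fun i => ψ (X i)) (Y σ) := by
    intro σ
    have h0 : ∀ j ∉ σ.1, Y σ j = 0 := fun j hj => by
      simp only [Y]
      rw [facetRestrictPoly_X_of_notMem a σ.2.2 hj, map_zero]
    refine ⟨h0, fun i => ?_⟩
    rw [← sum_orderEmbOfFin σ.2.2 fun j hj => by rw [h0 j hj, mul_zero],
      ← sum_facetMatrix_mul_facetCoord a σ.1 σ.2.2 (hdet σ) i, map_sum]
    refine Finset.sum_congr rfl fun r _ => ?_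
    rw [map_mul, ← hφψ, ← facetRestrictPoly_X_orderEmbOfFin]
    rfl
  have hy : ∀ σ : Facet Δ n, IsFacetCoords (a.map φ) σ.1 (fun i => φ (p i)) (y σ) := by
    intro σ
    have h := isFacetCoords_facetSolve σ.1 σ.2.2 (hdet σ) p
    refine ⟨fun j hj => by simp only [y]; rw [h.eq_zero j hj, map_zero], fun i => ?_⟩
    rw [← h.sum_eq i, map_sum]
    exact Finset.sum_congr rfl fun j _ => (map_mul φ _ _).symm
  have hne : ∀ σ : Facet Δ n, ∀ i ∈ σ.1, ∀ j ∈ σ.1, i ≠ j →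
      Y σ i * y σ j ≠ Y σ j * y σ i := by
    -- Compare both sides at the vertex `i`, where coordinate `i` is `1` and coordinate `j` is `0`.
    intro σ i hi j hj hij heq
    obtain ⟨r, rfl⟩ := exists_orderEmbOfFin_eq σ.2.2 hi
    obtain ⟨s, rfl⟩ := exists_orderEmbOfFin_eq σ.2.2 hj
    have hrs : s ≠ r := fun h => hij (by rw [h])
    simp only [Y, y, facetRestrictPoly_X_orderEmbOfFin, hφψ, ← map_mul] at heq
    have := congrArg (eval fun i => facetMatrix a σ.1 σ.2.2 i r) (hψi heq)
    simp only [map_mul, eval_facetCoord a σ.1 σ.2.2 (hdet σ), eval_C, if_pos, if_neg hrs,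
      one_mul, zero_mul] at this
    exact hp σ _ hj this
  have hY0 : ∀ σ : Facet Δ n, ∀ j ∈ σ.1, Y σ j ≠ 0 := by
    intro σ j hj h0
    obtain ⟨r, rfl⟩ := exists_orderEmbOfFin_eq σ.2.2 hj
    simp only [Y, facetRestrictPoly_X_orderEmbOfFin] at h0
    have := congrArg (eval fun i => facetMatrix a σ.1 σ.2.2 i r)
      (hψi (h0.trans (map_zero ψ).symm))
    simp [eval_facetCoord a σ.1 σ.2.2 (hdet σ)] at this
  have hmono : ∀ J : Fin N →₀ ℕ, ∑ j, J j = n → ∀ c : K,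
      brionIntegral Δ a (Ideal.Quotient.mk (stanleyReisnerIdeal K Δ) (monomial J c)) =
        φ (integralAt a Δ p (monomial J c)) := by
    intro J hJ c
    have key := sum_facets_eq hΔ (fun σ => by
      rw [hdet']; exact (map_ne_zero φ).mpr (hdet σ)) hY hy hY0
      (fun σ j hj => (map_ne_zero φ).mpr (hp σ j hj)) hne hJ
    have h1 : brionIntegral Δ a (Ideal.Quotient.mk (stanleyReisnerIdeal K Δ) (monomial J c)) =
        φ c * ∑ σ : Facet Δ n, (∏ j, Y σ j ^ J j) /
          ((facetMatrix (a.map φ) σ.1 σ.2.2).det * ∏ j ∈ σ.1, Y σ j) := by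
      rw [Finset.mul_sum]
      refine Finset.sum_congr rfl fun σ _ => ?_
      rw [algebraMap_facetChi, hdet', ← mul_div_assoc]
      congr 1
      change ψ (facetRestrictPoly a σ.1 σ.2.2 (monomial J c)) = _
      rw [monomial_eq, Finsupp.prod_fintype _ _ (fun _ => pow_zero _), map_mul, map_mul, map_prod,
        map_prod, hφψ, ← algebraMap_eq, AlgHom.commutes]
      simp only [map_pow]
      rfl
    rw [h1, key, integralAt_apply, map_sum, Finset.mul_sum]
    refine Finset.sum_congr rfl fun σ _ => ?_
    rw [hdet', ← mul_div_assoc, map_div₀, map_mul, map_prod, eval_monomial,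
      Finsupp.prod_fintype _ _ (fun _ => pow_zero _), map_mul, map_prod]
    simp only [map_pow]
    rfl
  rw [f.as_sum, map_sum, map_sum, map_sum, map_sum]
  refine Finset.sum_congr rfl fun J hJ => hmono J ?_ _
  have := hf (mem_support_iff.mp hJ)
  rw [← Finsupp.degree_eq_sum, ← this, Finsupp.degree_eq_weight_one]
  rfl

theorem mixedVolume_eq_integralAt [CharP K 2] {Δ : AbstractSimplicialComplex (Fin N)}
    (hΔ : IsPseudomanifold Δ n) (hdet : ∀ σ : Facet Δ n, (facetMatrix a σ.1 σ.2.2).det ≠ 0)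
    {p : Fin n → K} (hp : ∀ σ : Facet Δ n, ∀ j ∈ σ.1, facetSolve a σ.1 σ.2.2 p j ≠ 0)
    {f : MvPolynomial (Fin N) K} (hf : f.IsHomogeneous n) :
    mixedVolume Δ a f = integralAt a Δ p f := by
  have h1 : mixedVolume Δ a f =
      toBaseField n K (brionIntegral Δ a (Ideal.Quotient.mk (stanleyReisnerIdeal K Δ) f)) := by
    rw [mixedVolume, LinearMap.comp_apply, LinearMap.comp_apply, LinearMap.comp_apply,
      homogeneousComponent_of_mem hf, if_pos rfl]
    rfl
  rw [h1, brionIntegral_mk_eq_integralAt a hΔ hdet hp hf, toBaseField_algebraMap]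

end

theorem det_genericMatrix_submatrix_ne_zero (k : Type*) [Field k] {m n N : ℕ} {f : Fin m → Fin n}
    {g : Fin m → Fin N} (hf : Function.Injective f) (hg : Function.Injective g) :
    ((genericMatrix k n N).submatrix f g).det ≠ 0 := by
  have hmap : (genericMatrix k n N).submatrix f g =
      (algebraMap (MvPolynomial (Fin n × Fin N) k) (GenericField k n N)).mapMatrix
        ((rename (Prod.map f g)).toRingHom.mapMatrix
          (Matrix.mvPolynomialX (Fin m) (Fin m) k)) := by
    ext i j
    simp [genericMatrix, Matrix.mvPolynomialX]
  rw [hmap, ← RingHom.map_det, ← RingHom.map_det]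
  exact (map_ne_zero_iff _ (IsFractionRing.injective _ _)).mpr
    ((map_ne_zero_iff _ (rename_injective _ (hf.prodMap hg))).mpr
      (Matrix.det_mvPolynomialX_ne_zero (Fin m) k))

/-- By Cramer's rule these coordinates are, up to sign, quotients of minors of the generic matrix. -/
theorem facetSolve_genericMatrix_ne_zero (k : Type*) [Field k] {n N : ℕ} (r₀ : Fin n)
    {σ : Finset (Fin N)} (h : σ.card = n) {j : Fin N} (hj : j ∈ σ) :
    facetSolve (genericMatrix k n N) σ h (Pi.single r₀ 1) j ≠ 0 := by
  obtain ⟨r, rfl⟩ := exists_orderEmbOfFin_eq h hj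
  cases n with
  | zero => exact r₀.elim0
  | succ n =>
    have hsub : (facetMatrix (genericMatrix k (n + 1) N) σ h).submatrix r₀.succAbove
        r.succAbove = (genericMatrix k (n + 1) N).submatrix r₀.succAbove
          (σ.orderEmbOfFin h ∘ r.succAbove) := rfl
    rw [facetSolve_orderEmbOfFin, Matrix.mulVec_single_one, Matrix.col_apply, Matrix.inv_def,
      Matrix.smul_apply, Matrix.adjugate_fin_succ_eq_det_submatrix, hsub, smul_eq_mul,
      Ring.inverse_eq_inv']
    refine mul_ne_zero (inv_ne_zero (det_facetMatrix_genericMatrix_ne_zero k σ h))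
      (mul_ne_zero (pow_ne_zero _ (neg_ne_zero.mpr one_ne_zero)) ?_)
    exact det_genericMatrix_submatrix_ne_zero k Fin.succAbove_right_injective
      ((σ.orderEmbOfFin h).injective.comp Fin.succAbove_right_injective)

/-! ### The Frobenius expansion of the integral -/

/-- The exponent vector of the monomial `x_{I_1} ⋯ x_{I_n}`. -/
def wordExponent {n : ℕ} {α : Type*} (I : Fin n → α) : α →₀ ℕ :=
  ∑ r, Finsupp.single (I r) 1

theorem wordExponent_cons {n : ℕ} {α : Type*} (j : α) (I : Fin n → α) :
    wordExponent (Fin.cons j I : Fin (n + 1) → α) = Finsupp.single j 1 + wordExponent I := by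
  simp [wordExponent, Fin.sum_univ_succ]

theorem exists_eq_add_wordExponent {α : Type*} (n : ℕ) (P : α →₀ ℕ) (hP : n ≤ P.degree) :
    ∃ (H : α →₀ ℕ) (I : Fin n → α), P = H + wordExponent I := by
  induction n generalizing P with
  | zero => exact ⟨P, Fin.elim0, by simp [wordExponent]⟩
  | succ n ih =>
    have hP0 : P ≠ 0 := by rintro rfl; simp at hP
    obtain ⟨j, hj⟩ := Finsupp.ne_iff.mp hP0
    have hle : Finsupp.single j 1 ≤ P := Finsupp.single_le_iff.mpr (Nat.one_le_iff_ne_zero.mpr hj)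
    obtain ⟨P', rfl⟩ := exists_add_of_le hle
    rw [map_add, Finsupp.degree_single] at hP
    obtain ⟨H, I, rfl⟩ := ih P' (by omega)
    exact ⟨H, Fin.cons j I, by rw [wordExponent_cons]; abel⟩

theorem degree_wordExponent {n : ℕ} {α : Type*} (I : Fin n → α) :
    (wordExponent I).degree = n := by
  simp [wordExponent]

/-- The vector of halves of the exponents of a monomial, rounded down. -/
def halfExponent {α : Type*} (P : α →₀ ℕ) : α →₀ ℕ :=
  P.mapRange (· / 2) rfl

theorem halfExponent_add_self {α : Type*} (M : α →₀ ℕ) : halfExponent (M + M) = M := by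
  ext j
  simp [halfExponent]
  omega

theorem add_halfExponent {α : Type*} {P : α →₀ ℕ} (hP : ∀ j, Even (P j)) :
    halfExponent P + halfExponent P = P := by
  ext j
  have := hP j
  simp only [halfExponent, Finsupp.add_apply, Finsupp.mapRange_apply]
  obtain ⟨c, hc⟩ := this
  omega

section

variable {K : Type*} [Field K] {n N : ℕ} (a : Matrix (Fin n) (Fin N) K)

theorem eval_monomial_wordExponent {α : Type*} (y : α → K) (I : Fin n → α) :
    eval y (monomial (wordExponent I) 1) = ∏ r, y (I r) := by
  rw [wordExponent, monomial_sum_one, map_prod]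
  simp [eval_monomial]

/-- The contribution of one facet to the Frobenius expansion, with denominators cleared. After
division by `x^J` it is the parity sum of the matrix `a r j * y j`, whose rows sum to the coordinates
of a standard basis vector. -/
theorem sum_even_prod_mul_eval_eq [CharP K 2] {σ : Finset (Fin N)} (h : σ.card = n) {r₀ : Fin n}
    {y : Fin N → K} (hy : IsFacetCoords a σ (Pi.single r₀ 1) y) {J : Fin N →₀ ℕ}
    (hJ : Even (J.degree + n)) :
    ∑ I : Fin n → Fin N with ∀ j, Even ((J + wordExponent I) j),
        (∏ r, a r (I r)) * eval y (monomial (J + wordExponent I) 1) =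
      ((facetMatrix a σ h).det * ∏ j ∈ σ, y j) * eval y (monomial J 1) := by
  classical
  have hsplit : ∀ I : Fin n → Fin N, eval y (monomial (J + wordExponent I) 1) =
      eval y (monomial J 1) * ∏ r, y (I r) := fun I => by
    rw [← eval_monomial_wordExponent y I, ← map_mul, monomial_mul, one_mul]
  by_cases hsupp : ∀ j, J j ≠ 0 → j ∈ σ
  swap
  · push Not at hsupp
    obtain ⟨j, hj, hjσ⟩ := hsupp
    have h0 : eval y (monomial J 1) = 0 := by
      rw [eval_monomial, Finsupp.prod_fintype _ _ (fun _ => pow_zero _),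
        Finset.prod_eq_zero (Finset.mem_univ j) (by rw [hy.eq_zero j hjσ, zero_pow hj]), mul_zero]
    simp [hsplit, h0]
  let c : Matrix (Fin n) (Fin n) K := Matrix.of fun r s =>
    y (σ.orderEmbOfFin h s) * facetMatrix a σ h r s
  have hc : ∀ r, ∑ s, c r s = if r = r₀ then 1 else 0 := by
    intro r
    have := hy.sum_eq r
    rw [← sum_orderEmbOfFin h fun j hj => by rw [hy.eq_zero j hj, mul_zero],
      Pi.single_apply] at this
    rw [← this]
    exact Finset.sum_congr rfl fun s _ => mul_comm _ _
  have hdet : c.det = (facetMatrix a σ h).det * ∏ j ∈ σ, y j := by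
    rw [Matrix.det_mul_row, prod_orderEmbOfFin, mul_comm]
  let T : Fin n → ZMod 2 := fun s => (J (σ.orderEmbOfFin h s) : ZMod 2)
  have hT : ∑ s, T s = Fintype.card (Fin n) := by
    rw [sum_orderEmbOfFin h (f := fun j => (J j : ZMod 2)) fun j hj => by
      rw [not_imp_comm.mp (hsupp j) hj, Nat.cast_zero], ← Nat.cast_sum, ← Finsupp.degree_eq_sum,
      Fintype.card_fin, ← CharTwo.add_eq_zero, ← Nat.cast_add, ZMod.natCast_eq_zero_iff_even]
    exact hJ
  have key := sum_filter_parity_prod_eq_det c r₀ hc T hT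
  have hcount : ∀ (I : Fin n → Fin N) (j : Fin N), (wordExponent I) j =
      ∑ r, if I r = j then 1 else 0 := fun I j => by
    simp [wordExponent, Finsupp.finsetSum_apply, Finsupp.single_apply]
  have hparity : ∀ I : Fin n → Fin n,
      (∀ j, Even ((J + wordExponent (σ.orderEmbOfFin h ∘ I)) j)) ↔
        ∑ r, Pi.single (I r) 1 = T := by
    intro I
    have h1 : ∀ s, (∑ r, Pi.single (I r) 1 : Fin n → ZMod 2) s =
        (wordExponent (σ.orderEmbOfFin h ∘ I) (σ.orderEmbOfFin h s) : ZMod 2) := by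
      intro s
      rw [hcount, Finset.sum_apply, Nat.cast_sum]
      refine Finset.sum_congr rfl fun r _ => ?_
      simp [Pi.single_apply, eq_comm]
    constructor
    · intro he
      funext s
      rw [h1]
      have := (ZMod.natCast_eq_zero_iff_even).mpr (he (σ.orderEmbOfFin h s))
      rw [Finsupp.add_apply, Nat.cast_add, CharTwo.add_eq_zero] at this
      exact this.symm
    · intro he j
      by_cases hj : j ∈ σ
      · obtain ⟨s, rfl⟩ := exists_orderEmbOfFin_eq h hj
        have := congrFun he s
        rw [h1] at this
        rw [← ZMod.natCast_eq_zero_iff_even, Finsupp.add_apply, Nat.cast_add, this]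
        exact CharTwo.add_self_eq_zero _
      · have h2 : wordExponent (σ.orderEmbOfFin h ∘ I) j = 0 := by
          rw [hcount]
          refine Finset.sum_eq_zero fun r _ => if_neg ?_
          rintro rfl
          exact hj (Finset.orderEmbOfFin_mem σ h _)
        rw [Finsupp.add_apply, h2, not_imp_comm.mp (hsupp j) hj]
        exact Even.zero
  rw [← hdet, ← key, Finset.sum_mul]
  symm
  refine Finset.sum_of_injOn (fun I => σ.orderEmbOfFin h ∘ I)
    (fun I _ I' _ hI => (σ.orderEmbOfFin h).injective.comp_left hI)
    (fun I hI => ?_) (fun I hI hI' => ?_) (fun I _ => ?_)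
  · simp only [Finset.coe_filter, Finset.mem_univ, true_and, Set.mem_ofPred_eq] at hI ⊢
    exact (hparity I).mpr hI
  · have : ∃ r, I r ∉ σ := by
      by_contra hall
      push Not at hall
      choose I' hI'' using fun r => exists_orderEmbOfFin_eq h (hall r)
      have hII : σ.orderEmbOfFin h ∘ I' = I := funext hI''
      refine hI' ⟨I', ?_, hII⟩
      simp only [Finset.coe_filter, Finset.mem_univ, true_and, Set.mem_ofPred_eq]
      rw [← hparity, hII]
      exact (Finset.mem_filter.mp hI).2
    obtain ⟨r, hr⟩ := this
    rw [hsplit, Finset.prod_eq_zero (f := fun r => y (I r)) (Finset.mem_univ r) (hy.eq_zero _ hr),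
      mul_zero, mul_zero]
  · rw [hsplit]
    simp only [c, Matrix.of_apply, Finset.prod_mul_distrib, Function.comp_apply, facetMatrix]
    ring

/-- The Frobenius expansion of the integral of `g²` times a sum of monomials. For a single monomial
`x^J` it reads `W(g² x^J) = ∑_I a_{1,I_1} ⋯ a_{n,I_n} · W(g √(x^J x_I))²`. -/
theorem integralAt_sq_mul_sum_monomial [CharP K 2] {Δ : AbstractSimplicialComplex (Fin N)}
    (hdet : ∀ σ : Facet Δ n, (facetMatrix a σ.1 σ.2.2).det ≠ 0) {r₀ : Fin n}
    (hp : ∀ σ : Facet Δ n, ∀ j ∈ σ.1, facetSolve a σ.1 σ.2.2 (Pi.single r₀ 1) j ≠ 0)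
    (g : MvPolynomial (Fin N) K) {ι : Type*} (s : Finset ι) (J : ι → Fin N →₀ ℕ)
    (hJ : ∀ i ∈ s, Even ((J i).degree + n)) :
    integralAt a Δ (Pi.single r₀ 1) (g ^ 2 * ∑ i ∈ s, monomial (J i) 1) =
      ∑ I : Fin n → Fin N, (∏ r, a r (I r)) *
        (∑ i ∈ s with ∀ j, Even ((J i + wordExponent I) j), integralAt a Δ (Pi.single r₀ 1)
          (g * monomial (halfExponent (J i + wordExponent I)) 1)) ^ 2 := by
  simp only [CharTwo.sum_sq, Finset.mul_sum, map_sum]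
  simp only [Finset.sum_filter]
  rw [Finset.sum_comm]
  refine Finset.sum_congr rfl fun i hi => ?_
  rw [← Finset.sum_filter]
  simp only [integralAt_apply, CharTwo.sum_sq, Finset.mul_sum]
  rw [Finset.sum_comm]
  refine Finset.sum_congr rfl fun σ _ => ?_
  set y := facetSolve a σ.1 σ.2.2 (Pi.single r₀ 1) with hy
  have hχ : (facetMatrix a σ.1 σ.2.2).det * ∏ j ∈ σ.1, y j ≠ 0 :=
    mul_ne_zero (hdet σ) (Finset.prod_ne_zero_iff.mpr (hp σ))
  have key := sum_even_prod_mul_eval_eq a σ.2.2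
    (isFacetCoords_facetSolve σ.1 σ.2.2 (hdet σ) (Pi.single r₀ 1)) (hJ i hi)
  rw [← hy] at key
  set χ := (facetMatrix a σ.1 σ.2.2).det * ∏ j ∈ σ.1, y j
  calc eval y (g ^ 2 * monomial (J i) 1) / χ
      = eval y g ^ 2 / χ ^ 2 * (χ * eval y (monomial (J i) 1)) := by
        rw [map_mul, map_pow]
        field_simp
    _ = _ := by
        rw [← key, Finset.mul_sum]
        refine Finset.sum_congr rfl fun I hI => ?_
        have h2 : eval y (monomial (J i + wordExponent I) 1) =
            eval y (monomial (halfExponent (J i + wordExponent I)) 1) ^ 2 := by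
          rw [← map_pow, sq, monomial_mul, one_mul, add_halfExponent (Finset.mem_filter.mp hI).2]
        rw [h2, map_mul]
        ring

end

/-! ### Descent from squares -/

theorem wordExponent_injective_rows {n N : ℕ} :
    Function.Injective fun I : Fin n → Fin N => wordExponent fun r => (r, I r) := by
  intro I I' h
  funext r
  have h1 : ∀ I : Fin n → Fin N, ∀ j, wordExponent (fun r => (r, I r)) (r, j) =
      if I r = j then 1 else 0 := by
    intro I j
    simp [wordExponent, Finsupp.finsetSum_apply, Finsupp.single_apply, Prod.ext_iff, ite_and]
  have h2 := DFunLike.congr_fun h (r, I r)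
  simp only [h1, if_true] at h2
  by_contra hne
  simp [Ne.symm hne] at h2

theorem wordExponent_rows_le_one {n N : ℕ} (I : Fin n → Fin N) (x : Fin n × Fin N) :
    wordExponent (fun r => (r, I r)) x ≤ 1 := by
  obtain ⟨r, j⟩ := x
  simp only [wordExponent, Finsupp.finsetSum_apply, Finsupp.single_apply, Prod.ext_iff, ite_and,
    Finset.sum_ite_eq', Finset.mem_univ, if_true]
  split_ifs <;> simp

theorem prod_genericMatrix (k : Type*) [Field k] {n N : ℕ} (I : Fin n → Fin N) :
    ∏ r, genericMatrix k n N r (I r) =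
      algebraMap (MvPolynomial (Fin n × Fin N) k) (GenericField k n N)
        (monomial (wordExponent fun r => (r, I r)) 1) := by
  rw [wordExponent, monomial_sum_one, map_prod]
  rfl

theorem IsPseudomanifold.pos {n N : ℕ} {Δ : AbstractSimplicialComplex (Fin N)}
    (hΔ : IsPseudomanifold Δ n) : 0 < n := by
  obtain ⟨s, hs⟩ := hΔ.nonempty
  obtain ⟨σ, hσ, -, hcard⟩ := hΔ.pure s hs
  rw [← hcard]
  exact Finset.card_pos.mpr (Δ.isRelLowerSet_faces hσ).1

section

variable {k : Type*} [Field k] [CharP k 2] {n N : ℕ} {Δ : AbstractSimplicialComplex (Fin N)}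

instance charP_genericField : CharP (GenericField k n N) 2 :=
  charP_of_injective_algebraMap (algebraMap k (GenericField k n N)).injective 2

/-- If `q g² = 0` in `H̄(Δ)` for a sum of monomials `q = ∑ x^{E i}` with exponents distinct modulo
two, each square `x^{2M}` of the relevant degree being divisible by one of them, then `g = 0`. The
proof of `W(g x^M) = 0` picks `i₀` with `x^{E i₀} ∣ x^{2M}`, writes `x^{2M} = x^{E i₀} x^H x_I`, and
looks at the coefficient of `a_{1,I_1} ⋯ a_{n,I_n}` in the expansion of `W(q x^H g²)`; there only
the monomial `x^{E i₀}` of `q` contributes. -/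
theorem mem_gorensteinIdeal_of_sum_monomial_mul_sq_mem (hΔ : IsPseudomanifold Δ n) {m d : ℕ}
    (hm : 2 * m + d ≤ n) {ι : Type*} (s : Finset ι) {E : ι → Fin N →₀ ℕ}
    (hEd : ∀ i ∈ s, (E i).degree = d)
    (hE : ∀ M : Fin N →₀ ℕ, M.degree = n - m → ∃ i₀ ∈ s, E i₀ ≤ M + M ∧
      ∀ i ∈ s, (∀ j, Even (E i j + E i₀ j)) → i = i₀)
    {g : MvPolynomial (Fin N) (GenericField k n N)} (hg : g.IsHomogeneous m)
    (h : (∑ i ∈ s, monomial (E i) 1) * g ^ 2 ∈ gorensteinIdeal Δ (genericMatrix k n N)) :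
    g ∈ gorensteinIdeal Δ (genericMatrix k n N) := by
  classical
  have hdet : ∀ σ : Facet Δ n, (facetMatrix (genericMatrix k n N) σ.1 σ.2.2).det ≠ 0 := fun σ =>
    det_facetMatrix_genericMatrix_ne_zero k σ.1 σ.2.2
  let r₀ : Fin n := ⟨0, hΔ.pos⟩
  have hp := fun (σ : Facet Δ n) (j : Fin N) hj =>
    facetSolve_genericMatrix_ne_zero k r₀ σ.2.2 (j := j) hj
  have hV := fun {f} hf => mixedVolume_eq_integralAt (genericMatrix k n N) hΔ hdet hp (f := f) hf
  have hmono : ∀ M : Fin N →₀ ℕ, M.degree = n - m →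
      mixedVolume Δ (genericMatrix k n N) (g * monomial M 1) = 0 := by
    intro M hM
    obtain ⟨i₀, hi₀, hle, huniq⟩ := hE M hM
    obtain ⟨P, hP⟩ := exists_add_of_le hle
    have hPdeg : d + P.degree = 2 * (n - m) := by
      have := congrArg Finsupp.degree hP
      rw [map_add, map_add, hEd i₀ hi₀, hM] at this
      omega
    obtain ⟨H, I, rfl⟩ := exists_eq_add_wordExponent n P (by omega)
    rw [map_add, degree_wordExponent] at hPdeg
    have hdeg : ∀ i ∈ s, (E i + H).degree = n - 2 * m := fun i hi => by
      rw [map_add, hEd i hi]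
      omega
    have h1 : integralAt (genericMatrix k n N) Δ (Pi.single r₀ 1)
        (g ^ 2 * ∑ i ∈ s, monomial (E i + H) 1) = 0 := by
      rw [← hV]
      · have : g ^ 2 * ∑ i ∈ s, monomial (E i + H) (1 : GenericField k n N) =
            ((∑ i ∈ s, monomial (E i) 1) * g ^ 2) * monomial H 1 := by
          rw [mul_comm _ (g ^ 2), mul_assoc, Finset.sum_mul]
          simp only [monomial_mul, one_mul]
        rw [this]
        exact h _
      · have hh := (hg.pow 2).mul (IsHomogeneous.sum s (fun i => monomial (E i + H)
          (1 : GenericField k n N)) _ fun i hi => isHomogeneous_monomial _ (hdeg i hi))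
        rwa [show m * 2 + (n - 2 * m) = n by omega] at hh
    rw [integralAt_sq_mul_sum_monomial _ hdet hp g s (fun i => E i + H) (fun i hi => by
      rw [hdeg i hi]; exact ⟨n - m, by omega⟩)] at h1
    simp only [prod_genericMatrix] at h1
    have h2 := eq_zero_of_sum_monomial_mul_sq_eq_zero wordExponent_injective_rows
      wordExponent_rows_le_one h1 I
    have hfilter : (s.filter fun i => ∀ j, Even ((E i + H + wordExponent I) j)) = {i₀} := by
      ext i
      rw [Finset.mem_filter, Finset.mem_singleton]
      have hpt : ∀ j, E i j + E i₀ j + (H j + wordExponent I j + E i₀ j) =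
          (E i + H + wordExponent I) j + 2 * E i₀ j := fun j => by
        simp only [Finsupp.add_apply]; ring
      have hM2 : ∀ j, H j + wordExponent I j + E i₀ j = M j + M j := fun j => by
        have := DFunLike.congr_fun hP j
        simp only [Finsupp.add_apply] at this
        omega
      have hiff : ∀ j, Even ((E i + H + wordExponent I) j) ↔ Even (E i j + E i₀ j) := fun j => by
        have h3 := hpt j
        rw [hM2] at h3
        simp only [Nat.even_iff]
        omega
      simp only [hiff]
      refine ⟨fun hi => huniq i hi.1 hi.2, ?_⟩
      rintro rfl
      exact ⟨hi₀, fun j => ⟨_, rfl⟩⟩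
    rw [hfilter, Finset.sum_singleton, add_assoc, ← hP, halfExponent_add_self] at h2
    have hh := hg.mul (isHomogeneous_monomial (1 : GenericField k n N) hM)
    rw [show m + (n - m) = n by omega] at hh
    rw [hV hh, h2]
  rw [mem_gorensteinIdeal_iff Δ _ (by omega) hg]
  intro q hq
  rw [q.as_sum, Finset.mul_sum, map_sum]
  refine Finset.sum_eq_zero fun M hM => ?_
  have hMdeg : M.degree = n - m := by
    rw [← hq (mem_support_iff.mp hM), Finsupp.degree_eq_weight_one]
    rfl
  have : g * monomial M (coeff M q) = coeff M q • (g * monomial M 1) := by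
    rw [← mul_smul_comm, smul_monomial, smul_eq_mul, mul_one]
  rw [this, map_smul, hmono M hMdeg, smul_zero]

theorem mem_gorensteinIdeal_of_sq_mem (hΔ : IsPseudomanifold Δ n) {m : ℕ} (hm : 2 * m ≤ n)
    {g : MvPolynomial (Fin N) (GenericField k n N)} (hg : g.IsHomogeneous m)
    (h : g ^ 2 ∈ gorensteinIdeal Δ (genericMatrix k n N)) :
    g ∈ gorensteinIdeal Δ (genericMatrix k n N) := by
  refine mem_gorensteinIdeal_of_sum_monomial_mul_sq_mem hΔ (d := 0) (by omega)
    ({()} : Finset Unit) (E := fun _ => 0) (by simp)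
    (fun M _ => ⟨(), by simp, by simp, by simp⟩) hg ?_
  simpa using h

theorem mem_gorensteinIdeal_of_sum_X_mul_sq_mem (hΔ : IsPseudomanifold Δ n) {m : ℕ}
    (hm : 2 * m + 1 ≤ n) {g : MvPolynomial (Fin N) (GenericField k n N)} (hg : g.IsHomogeneous m)
    (h : (∑ j, X j) * g ^ 2 ∈ gorensteinIdeal Δ (genericMatrix k n N)) :
    g ∈ gorensteinIdeal Δ (genericMatrix k n N) := by
  refine mem_gorensteinIdeal_of_sum_monomial_mul_sq_mem hΔ hm Finset.univ
    (E := fun j => Finsupp.single j 1) (by simp) (fun M hM => ?_) hg h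
  have hM0 : M ≠ 0 := by
    rintro rfl
    simp at hM
    omega
  obtain ⟨j, hj⟩ := Finsupp.ne_iff.mp hM0
  refine ⟨j, Finset.mem_univ _, (Finsupp.single_le_iff.mpr
    (Nat.one_le_iff_ne_zero.mpr hj)).trans le_self_add, fun i _ hi => ?_⟩
  by_contra hij
  have := hi j
  simp [hij] at this

theorem mem_gorensteinIdeal_of_pow_mul_sq_mem (hΔ : IsPseudomanifold Δ n) (s : ℕ) {m : ℕ}
    (hm : 2 * m + s ≤ n) {g : MvPolynomial (Fin N) (GenericField k n N)} (hg : g.IsHomogeneous m)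
    (h : (∑ j, X j) ^ s * g ^ 2 ∈ gorensteinIdeal Δ (genericMatrix k n N)) :
    g ∈ gorensteinIdeal Δ (genericMatrix k n N) := by
  induction s using Nat.strong_induction_on with
  | _ s ih =>
    have hl : (∑ j, X j : MvPolynomial (Fin N) (GenericField k n N)).IsHomogeneous 1 :=
      IsHomogeneous.sum _ _ _ fun j _ => isHomogeneous_X _ j
    rcases Nat.eq_zero_or_pos s with rfl | hs
    · exact mem_gorensteinIdeal_of_sq_mem hΔ (by omega) hg (by simpa using h)
    have hlg : ((∑ j, X j) ^ (s / 2) * g).IsHomogeneous (s / 2 + m) := by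
      simpa using (hl.pow (s / 2)).mul hg
    have hmem : (∑ j, X j) ^ (s / 2) * g ∈ gorensteinIdeal Δ (genericMatrix k n N) := by
      -- `l^s g²` is `(l^{⌊s/2⌋} g)²` or `l (l^{⌊s/2⌋} g)²`, according to the parity of `s`.
      rcases Nat.even_or_odd' s with ⟨u, hu | hu⟩
      · refine mem_gorensteinIdeal_of_sq_mem hΔ (by omega) hlg ?_
        convert h using 1
        rw [show s / 2 = u by omega, hu]
        ring
      · refine mem_gorensteinIdeal_of_sum_X_mul_sq_mem hΔ (by omega) hlg ?_
        convert h using 1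
        rw [show s / 2 = u by omega, hu]
        ring
    refine ih (s / 2) (by omega) (by omega) ?_
    rw [sq, ← mul_assoc]
    exact Ideal.mul_mem_right _ _ hmem

end

end

theorem mainTheorem2 {k : Type*} [Field k] [CharP k 2] {n N : ℕ}
    (Δ : AbstractSimplicialComplex (Fin N)) (hΔ : IsPseudomanifold Δ n) :
    (∀ f : MvPolynomial (Fin N) (GenericField k n N), f.IsHomogeneous n →
      algebraMap (GenericField k n N) (FractionRing (MvPolynomial (Fin n) (GenericField k n N)))
          (mixedVolume Δ (genericMatrix k n N) f) =
        brionIntegral Δ (genericMatrix k n N)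
          (Ideal.Quotient.mk (stanleyReisnerIdeal (GenericField k n N) Δ) f)) ∧
    ∀ m : ℕ, 2 * m ≤ n → (lefschetzForm Δ (genericMatrix k n N) m).Anisotropic := by
  have hdet : ∀ σ : Facet Δ n, (facetMatrix (genericMatrix k n N) σ.1 σ.2.2).det ≠ 0 := fun σ =>
    det_facetMatrix_genericMatrix_ne_zero k σ.1 σ.2.2
  have hp := fun (σ : Facet Δ n) (j : Fin N) hj =>
    facetSolve_genericMatrix_ne_zero k ⟨0, hΔ.pos⟩ σ.2.2 (j := j) hj
  refine ⟨fun f hf => ?_, fun m hm => ?_⟩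
  · rw [mixedVolume_eq_integralAt _ hΔ hdet hp hf, brionIntegral_mk_eq_integralAt _ hΔ hdet hp hf]
  · rintro ⟨_, g, hg, rfl⟩ hx
    rw [lefschetzForm_apply] at hx
    have hx' : mixedVolume Δ (genericMatrix k n N) ((∑ j, X j) ^ (n - 2 * m) * g ^ 2) = 0 := hx
    have hl : (∑ j, X j : MvPolynomial (Fin N) (GenericField k n N)).IsHomogeneous 1 :=
      IsHomogeneous.sum _ _ _ fun j _ => isHomogeneous_X _ j
    have hg' : g.IsHomogeneous m := (mem_homogeneousSubmodule m g).mp hg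
    have hhom : ((∑ j, X j) ^ (n - 2 * m) * g ^ 2).IsHomogeneous n := by
      have h1 := (hl.pow (n - 2 * m)).mul (hg'.pow 2)
      rwa [show 1 * (n - 2 * m) + m * 2 = n by omega] at h1
    have hmem : (∑ j, X j) ^ (n - 2 * m) * g ^ 2 ∈ gorensteinIdeal Δ (genericMatrix k n N) := by
      rw [mem_gorensteinIdeal_iff Δ _ le_rfl hhom]
      intro q hq
      rw [Nat.sub_self] at hq
      obtain ⟨c, rfl⟩ : ∃ c, q = C c := ⟨_, totalDegree_eq_zero_iff_eq_C.mp
        (Nat.le_zero.mp hq.totalDegree_le)⟩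
      rw [mul_comm, ← smul_eq_C_mul, map_smul, hx', smul_zero]
    exact Subtype.ext (Ideal.Quotient.eq_zero_iff_mem.mpr
      (mem_gorensteinIdeal_of_pow_mul_sq_mem hΔ _ (by omega) hg' hmem))
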